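/- All Hilbert spaces are finite-dimensional, $\|X\|=\mathrm{Tr}\sqrt{X^\dagger X}$ is the trace norm, and a state is a density matrix. An LOPC operation on tripartite operators (systems of Alice, Bob and Eve) is a composition of quantum channels acting on Alice's system alone, quantum channels acting on Bob's system alone, and public communication, i.e. maps $\rho_{aABE}\mapsto\sum_i P_i\,\rho_{aABE}\,P_i\otimes|i\rangle\langle i|_b\otimes|i\rangle\langle i|_e$ with $P_i=|i\rangle\langle i|_a\otimes I_{ABE}$, in which a message register $a$ of Alice is measured and copied to new registers $b$ of Bob and $e$ of Eve, and the same with Alice and Bob exchanged. LOCC operations on bipartite operators are defined in the same way without Eve's systems. A ccq state with $d\times d$ classical part is a state $\sum_{i,j}p_{ij}|ij\rangle\langle ij|_{AB}\otimes\rho^E_{ij}$ with $i,j\in\{0,\dots,d-1\}$, where $(p_{ij})$ is a probability distribution and the $\rho^E_{ij}$ are states; it is ideal if it has the form $\frac1d\sum_i|ii\rangle\langle ii|_{AB}\otimes\rho^E$. A pdit with $d\times d$ key part is a state $\gamma=\frac1d\sum_{i,j}|e_if_i\rangle\langle e_jf_j|_{AB}\otimes U_i\,\sigma_{A'B'}\,U_j^\dagger$,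 where $(e_i)$ and $(f_i)$ are orthonormal bases of the $d$-dimensional key systems $A$, $B$, $\sigma_{A'B'}$ is a state of arbitrary shield systems $A'$, $B'$, and the $U_i$ are unitaries on $A'B'$; Alice holds $AA'$ and Bob holds $BB'$. For a bipartite state $\rho_{AB}$ let $K_D(\rho_{AB})=\sup\,\limsup_{n\to\infty}\frac1n\log_2 d_n$, the supremum over all sequences of LOCC operations $P_n$ such that $\|P_n(\rho_{AB}^{\otimes n})-\gamma_{d_n}\|\to0$ for some pdits $\gamma_{d_n}$ with $d_n\times d_n$ key part. For a tripartite state $\rho_{ABE}$ let $C_D(\rho_{ABE})=\sup\,\limsup_{n\to\infty}\frac1n\log_2 d_n$, the supremum over all sequences of LOPC operations $P_n$ such that $P_n(\rho_{ABE}^{\otimes n})$ is a ccq state with $d_n\times d_n$ classical part whose trace norm distance to some ideal ccq state with $d_n\times d_n$ classical part tends to $0$. Theorem. Let Alice and Bob share a state $\rho_{AB}$ and let Eve hold its purification, i.e. let $\psi_{ABE}$ be a vector with $\mathrm{Tr}_E|\psi\rangle\langle\psi|=\rho_{AB}$. Then for every $d$ and every real $\varepsilon$: (1) If some LOPC operation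 takes $|\psi\rangle\langle\psi|$ to a ccq state $\rho^{ccq}$ with $d\times d$ classical part such that $\|\rho^{ccq}-\rho^{ccq}_{ideal}\|\le\varepsilon$ for some ideal ccq state, then some LOCC operation takes $\rho_{AB}$ to a state $\rho_{out}$ such that $\|\rho_{out}-\gamma\|\le2\sqrt{\varepsilon}$ for some pdit $\gamma$ with $d\times d$ key part. (2) Conversely, if some LOCC operation takes $\rho_{AB}$ to a state $\rho_{out}$ such that $\|\rho_{out}-\gamma\|\le\varepsilon$ for some pdit $\gamma$ with $d\times d$ key part, then some LOPC operation takes $|\psi\rangle\langle\psi|$ to a ccq state $\rho^{ccq}$ with $d\times d$ classical part such that $\|\rho^{ccq}-\rho^{ccq}_{ideal}\|\le\sqrt{2\varepsilon}$ for some ideal ccq state. (3) Consequently the two key rates coincide: $K_D(\rho_{AB})=C_D(|\psi\rangle\langle\psi|)$. -/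

import Mathlib

open Matrix Filter Topology
open scoped Kronecker ComplexOrder

noncomputable section

namespace KeyDistill

/-- Density matrices on the Hilbert space with orthonormal basis indexed by the finite type `n`. -/
def IsState {n : Type} [Fintype n] (ρ : Matrix n n ℂ) : Prop :=
  ρ.PosSemidef ∧ ρ.trace = 1

open Classical in
/-- The trace norm: the sum of the singular values, that is, of the square roots of the
eigenvalues of `Xᴴ * X`. -/
def traceNorm {n : Type} [Fintype n] (X : Matrix n n ℂ) : ℝ :=
  ∑ i, √((isHermitian_conjTranspose_mul_self X).eigenvalues i)

/-- The rank one operator `|ψ⟩⟨ψ|`. -/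
def pureState {n : Type} (ψ : n → ℂ) : Matrix n n ℂ :=
  vecMulVec ψ (star ψ)

/-- The partial trace over the third system `E`. -/
def traceE {A B E : Type} [Fintype E] (ρ : Matrix (A × B × E) (A × B × E) ℂ) :
    Matrix (A × B) (A × B) ℂ :=
  of fun x y => ∑ e, ρ (x.1, x.2, e) (y.1, y.2, e)

/-- The vector `ψ` on `ABE` purifies the operator `ρ` on `AB`. -/
def IsPurification {A B E : Type} [Fintype E] (ψ : A × B × E → ℂ)
    (ρ : Matrix (A × B) (A × B) ℂ) : Prop :=
  traceE (pureState ψ) = ρ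

/-- The `n`-fold tensor power of a bipartite operator, regrouped as an operator on
`Aⁿ` and `Bⁿ`. -/
def tensorPower₂ {A B : Type} (ρ : Matrix (A × B) (A × B) ℂ) (n : ℕ) :
    Matrix ((Fin n → A) × (Fin n → B)) ((Fin n → A) × (Fin n → B)) ℂ :=
  of fun x y => ∏ k, ρ (x.1 k, x.2 k) (y.1 k, y.2 k)

/-- The `n`-fold tensor power of a tripartite operator, regrouped as an operator on
`Aⁿ`, `Bⁿ` and `Eⁿ`. -/
def tensorPower₃ {A B E : Type} (ρ : Matrix (A × B × E) (A × B × E) ℂ) (n : ℕ) :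
    Matrix ((Fin n → A) × (Fin n → B) × (Fin n → E))
      ((Fin n → A) × (Fin n → B) × (Fin n → E)) ℂ :=
  of fun x y => ∏ k, ρ (x.1 k, x.2.1 k, x.2.2 k) (y.1 k, y.2.1 k, y.2.2 k)

/-! ### Local operations and communication -/

open Classical in
/-- The matrices `K k` are the Kraus operators of a quantum channel (a completely positive trace
preserving map). The dimensions of input and output may differ, so that this covers adding
ancillas, unitaries and isometries, measurements, and partial traces. -/
def IsKraus {κ A A' : Type} [Fintype κ] [Fintype A] [Fintype A'] (K : κ → Matrix A' A ℂ) : Prop :=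
  ∑ k, (K k)ᴴ * K k = 1

/-- The map `X ↦ ∑ k, K k * X * (K k)ᴴ`. -/
def krausMap {κ A A' : Type} [Fintype κ] [Fintype A] (K : κ → Matrix A' A ℂ)
    (X : Matrix A A ℂ) : Matrix A' A' ℂ :=
  ∑ k, K k * X * (K k)ᴴ

/-- Public communication from Alice to Bob, overheard by Eve: the register `x` of Alice, which
carries the message, is measured in its standard basis, and the result is written into new
registers of Bob and of Eve, `ρ ↦ ∑ i, P i * ρ * P i ⊗ |i⟩⟨i| ⊗ |i⟩⟨i|` with `P i = |i⟩⟨i|` on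
`x`. -/
def publicAB {x A B E : Type} [DecidableEq x]
    (ρ : Matrix ((x × A) × B × E) ((x × A) × B × E) ℂ) :
    Matrix ((x × A) × (x × B) × (x × E)) ((x × A) × (x × B) × (x × E)) ℂ :=
  of fun
    | ((i, a), (j, b), (k, e)), ((i', a'), (j', b'), (k', e')) =>
      if i = i' ∧ i = j ∧ i = j' ∧ i = k ∧ i = k' then ρ ((i, a), b, e) ((i, a'), b', e') else 0

/-- Public communication from Bob to Alice, overheard by Eve. -/
def publicBA {x A B E : Type} [DecidableEq x]
    (ρ : Matrix (A × (x × B) × E) (A × (x × B) × E) ℂ) :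
    Matrix ((x × A) × (x × B) × (x × E)) ((x × A) × (x × B) × (x × E)) ℂ :=
  of fun
    | ((i, a), (j, b), (k, e)), ((i', a'), (j', b'), (k', e')) =>
      if j = j' ∧ j = i ∧ j = i' ∧ j = k ∧ j = k' then ρ (a, (j, b), e) (a', (j, b'), e') else 0

/-- Classical communication from Alice to Bob. -/
def classicalAB {x A B : Type} [DecidableEq x]
    (ρ : Matrix ((x × A) × B) ((x × A) × B) ℂ) :
    Matrix ((x × A) × (x × B)) ((x × A) × (x × B)) ℂ :=
  of fun
    | ((i, a), (j, b)), ((i', a'), (j', b')) =>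
      if i = i' ∧ i = j ∧ i = j' then ρ ((i, a), b) ((i, a'), b') else 0

/-- Classical communication from Bob to Alice. -/
def classicalBA {x A B : Type} [DecidableEq x]
    (ρ : Matrix (A × (x × B)) (A × (x × B)) ℂ) :
    Matrix ((x × A) × (x × B)) ((x × A) × (x × B)) ℂ :=
  of fun
    | ((i, a), (j, b)), ((i', a'), (j', b')) =>
      if j = j' ∧ j = i ∧ j = i' then ρ (a, (j, b)) (a', (j, b')) else 0

/-- Local operations and public communication: the operations on tripartite operators which are
compositions of local operations of Alice, local operations of Bob, and public communication
between Alice and Bob of which Eve receives a copy. All systems are finite-dimensional. -/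
inductive IsLOPC : ∀ {A B E A' B' E' : Type},
    (Matrix (A × B × E) (A × B × E) ℂ → Matrix (A' × B' × E') (A' × B' × E') ℂ) → Prop
  | refl {A B E : Type} [Fintype A] [Fintype B] [Fintype E] :
      IsLOPC (id : Matrix (A × B × E) (A × B × E) ℂ → _)
  | alice {κ A A' B E : Type} [Fintype κ] [Fintype A] [Fintype A'] [Fintype B] [Fintype E]
      [DecidableEq B] [DecidableEq E] (K : κ → Matrix A' A ℂ) (hK : IsKraus K) :
      IsLOPC (krausMap fun k => K k ⊗ₖ ((1 : Matrix B B ℂ) ⊗ₖ (1 : Matrix E E ℂ)))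
  | bob {κ A B B' E : Type} [Fintype κ] [Fintype A] [Fintype B] [Fintype B'] [Fintype E]
      [DecidableEq A] [DecidableEq E] (K : κ → Matrix B' B ℂ) (hK : IsKraus K) :
      IsLOPC (krausMap fun k => (1 : Matrix A A ℂ) ⊗ₖ (K k ⊗ₖ (1 : Matrix E E ℂ)))
  | sendAB {x A B E : Type} [Fintype x] [Fintype A] [Fintype B] [Fintype E] [DecidableEq x] :
      IsLOPC (publicAB (x := x) (A := A) (B := B) (E := E))
  | sendBA {x A B E : Type} [Fintype x] [Fintype A] [Fintype B] [Fintype E] [DecidableEq x] :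
      IsLOPC (publicBA (x := x) (A := A) (B := B) (E := E))
  | comp {A B E A' B' E' A'' B'' E'' : Type}
      {Λ : Matrix (A × B × E) (A × B × E) ℂ → Matrix (A' × B' × E') (A' × B' × E') ℂ}
      {Λ' : Matrix (A' × B' × E') (A' × B' × E') ℂ →
        Matrix (A'' × B'' × E'') (A'' × B'' × E'') ℂ}
      (h : IsLOPC Λ) (h' : IsLOPC Λ') : IsLOPC (Λ' ∘ Λ)

/-- Local operations and classical communication: the same class of operations on bipartite
operators, without the systems of Eve. -/
inductive IsLOCC : ∀ {A B A' B' : Type},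
    (Matrix (A × B) (A × B) ℂ → Matrix (A' × B') (A' × B') ℂ) → Prop
  | refl {A B : Type} [Fintype A] [Fintype B] : IsLOCC (id : Matrix (A × B) (A × B) ℂ → _)
  | alice {κ A A' B : Type} [Fintype κ] [Fintype A] [Fintype A'] [Fintype B]
      [DecidableEq B] (K : κ → Matrix A' A ℂ) (hK : IsKraus K) :
      IsLOCC (krausMap fun k => K k ⊗ₖ (1 : Matrix B B ℂ))
  | bob {κ A B B' : Type} [Fintype κ] [Fintype A] [Fintype B] [Fintype B']
      [DecidableEq A] (K : κ → Matrix B' B ℂ) (hK : IsKraus K) :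
      IsLOCC (krausMap fun k => (1 : Matrix A A ℂ) ⊗ₖ K k)
  | sendAB {x A B : Type} [Fintype x] [Fintype A] [Fintype B] [DecidableEq x] :
      IsLOCC (classicalAB (x := x) (A := A) (B := B))
  | sendBA {x A B : Type} [Fintype x] [Fintype A] [Fintype B] [DecidableEq x] :
      IsLOCC (classicalBA (x := x) (A := A) (B := B))
  | comp {A B A' B' A'' B'' : Type}
      {Λ : Matrix (A × B) (A × B) ℂ → Matrix (A' × B') (A' × B') ℂ}
      {Λ' : Matrix (A' × B') (A' × B') ℂ → Matrix (A'' × B'') (A'' × B'') ℂ}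
      (h : IsLOCC Λ) (h' : IsLOCC Λ') : IsLOCC (Λ' ∘ Λ)

/-! ### Classical key and private states -/

/-- The projector `|ij⟩⟨ij|` tensored with an operator of Eve. -/
def keyTensor {d : ℕ} {E : Type} (i j : Fin d) (σ : Matrix E E ℂ) :
    Matrix (Fin d × Fin d × E) (Fin d × Fin d × E) ℂ :=
  single i i 1 ⊗ₖ (single j j 1 ⊗ₖ σ)

/-- Ccq states with `d × d` classical part:
`∑ i j, p i j |ij⟩⟨ij| ⊗ σ i j` for a probability distribution `p` and states `σ i j` of Eve. -/
def IsCcq {d : ℕ} {E : Type} [Fintype E]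
    (β : Matrix (Fin d × Fin d × E) (Fin d × Fin d × E) ℂ) : Prop :=
  ∃ (p : Fin d → Fin d → ℝ) (σ : Fin d → Fin d → Matrix E E ℂ),
    (∀ i j, 0 ≤ p i j) ∧ ∑ i, ∑ j, p i j = 1 ∧ (∀ i j, IsState (σ i j)) ∧
    β = ∑ i, ∑ j, (p i j : ℂ) • keyTensor i j (σ i j)

/-- Ideal ccq states: `∑ i, (1 / d) |ii⟩⟨ii| ⊗ σ` for some state `σ` of Eve. -/
def IsIdealCcq {d : ℕ} {E : Type} [Fintype E]
    (β : Matrix (Fin d × Fin d × E) (Fin d × Fin d × E) ℂ) : Prop :=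
  ∃ σ : Matrix E E ℂ, IsState σ ∧ β = ∑ i, (1 / d : ℂ) • keyTensor i i σ

open Classical in
/-- Private states (pdits) with `d × d` key part. Alice holds a key system of dimension `d` and a
shield system `S`, Bob a key system of dimension `d` and a shield system `T`, and
`γ = (1 / d) ∑ i j, |e i, f i⟩⟨e j, f j| ⊗ U i * σ * (U j)ᴴ` for orthonormal bases `e`, `f` of the
key systems, a state `σ` of the two shields, and unitaries `U i` on the two shields. -/
def IsPdit {d : ℕ} {S T : Type} [Fintype S] [Fintype T]
    (γ : Matrix ((Fin d × S) × (Fin d × T)) ((Fin d × S) × (Fin d × T)) ℂ) : Prop :=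
  ∃ (e f : OrthonormalBasis (Fin d) ℂ (EuclideanSpace ℂ (Fin d)))
    (σ : Matrix (S × T) (S × T) ℂ) (U : Fin d → Matrix (S × T) (S × T) ℂ),
    IsState σ ∧ (∀ i, U i ∈ unitaryGroup (S × T) ℂ) ∧
    γ = (∑ i, ∑ j, (1 / d : ℂ) •
      ((vecMulVec (e i).ofLp (star (e j).ofLp) ⊗ₖ vecMulVec (f i).ofLp (star (f j).ofLp)) ⊗ₖ
        (U i * σ * (U j)ᴴ))).submatrix
          (Equiv.prodProdProdComm (Fin d) S (Fin d) T) (Equiv.prodProdProdComm (Fin d) S (Fin d) T)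

/-- By LOPC, Alice and Bob can reach from the tripartite state `ρ` a ccq state with `d × d`
classical part whose trace norm distance to some ideal ccq state is at most `ε`. -/
def LOPCDistillsKey {A B E : Type} (ρ : Matrix (A × B × E) (A × B × E) ℂ) (d : ℕ) (ε : ℝ) :
    Prop :=
  ∃ (E' : Type) (_ : Fintype E')
    (Λ : Matrix (A × B × E) (A × B × E) ℂ →
      Matrix (Fin d × Fin d × E') (Fin d × Fin d × E') ℂ)
    (β : Matrix (Fin d × Fin d × E') (Fin d × Fin d × E') ℂ),
    IsLOPC Λ ∧ IsCcq (Λ ρ) ∧ IsIdealCcq β ∧ traceNorm (Λ ρ - β) ≤ ε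

/-- By LOCC, Alice and Bob can reach from the bipartite state `ρ` a state whose trace norm distance
to some pdit with `d × d` key part is at most `ε`. -/
def LOCCDistillsPdit {A B : Type} (ρ : Matrix (A × B) (A × B) ℂ) (d : ℕ) (ε : ℝ) : Prop :=
  ∃ (S T : Type) (_ : Fintype S) (_ : Fintype T)
    (Λ : Matrix (A × B) (A × B) ℂ →
      Matrix ((Fin d × S) × (Fin d × T)) ((Fin d × S) × (Fin d × T)) ℂ)
    (γ : Matrix ((Fin d × S) × (Fin d × T)) ((Fin d × S) × (Fin d × T)) ℂ),
    IsLOCC Λ ∧ IsPdit γ ∧ traceNorm (Λ ρ - γ) ≤ ε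

/-- The rate `limsup (log₂ (d n) / n)` of a protocol with output dimensions `d n`. -/
def rate (d : ℕ → ℕ) : EReal :=
  limsup (fun n : ℕ => ((Real.logb 2 (d n) / n : ℝ) : EReal)) atTop

/-- The distillable key `K_D` of a bipartite state: the supremum of the rates of all sequences of
LOCC operations, the `n`-th one acting on `n` copies of `ρ`, whose outputs are asymptotically
close in trace norm to pdits with `d n × d n` key part. -/
def distillableKey {A B : Type} (ρ : Matrix (A × B) (A × B) ℂ) : EReal :=
  sSup {r | ∃ (d : ℕ → ℕ) (ε : ℕ → ℝ), Tendsto ε atTop (𝓝 0) ∧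
    (∀ n, 1 ≤ n → LOCCDistillsPdit (tensorPower₂ ρ n) (d n) (ε n)) ∧ r = rate d}

/-- The distillable classical key `C_D` of a tripartite state: the supremum of the rates of all
sequences of LOPC operations, the `n`-th one acting on `n` copies of `ρ`, whose outputs are
ccq states asymptotically close in trace norm to ideal ccq states of dimension `d n × d n`. -/
def distillableClassicalKey {A B E : Type} (ρ : Matrix (A × B × E) (A × B × E) ℂ) : EReal :=
  sSup {r | ∃ (d : ℕ → ℕ) (ε : ℕ → ℝ), Tendsto ε atTop (𝓝 0) ∧
    (∀ n, 1 ≤ n → LOPCDistillsKey (tensorPower₃ ρ n) (d n) (ε n)) ∧ r = rate d}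

end KeyDistill

end

/-!
Both directions compare pure states, in which Alice and Bob hold everything that Eve does not.

**Key to private state.** An LOPC operation has a coherent version (`IsLOPC.exists_coherent`), in
which Alice and Bob keep the environments of their channels and copies of their messages as
shields. It turns `ψ` into a pure state `Ψ` whose reduction to the keys and Eve is the ccq output,
and whose reduction to Alice and Bob is the output of an LOCC operation. If the ccq output is within
`ε` of an ideal one, Uhlmann's theorem, here derived from the Powers-Størmer inequality, gives a
purification `Φ` of the ideal ccq state with overlap at least `1 - ε / 2` with `Ψ`
(`exists_purification_overlap`). Its reduction to Alice and Bob is a private state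
(`isPdit_of_purifies_ideal`), and two pure states with real overlap `c` have reductions at trace
norm distance at most `2 √(1 - c ^ 2)` (`traceNorm_sub_le_of_overlap`), which is at most `2 √ε`.

**Private state to key.** An LOCC operation is imitated by LOPC so that Eve holds part of a system
purifying the output `ρ_out` (`IsLOCC.exists_coherent`). A private state has the form `V σ Vᴴ` for
an isometry `V` that creates a twisted maximally entangled key (`twistedIsometry`). Testing
`ρ_out` with the projection `V Vᴴ` succeeds with probability at least `1 - ε / 2`, because a test
against the unitary `2 V Vᴴ - 1` is bounded by the trace norm. So the pure state of Alice, Bob and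
the environment has overlap with some unit vector `φ` in the range of `V` whose square is at least
`1 - ε / 2`. Measuring the keys of `φ` gives an ideal ccq state
(`isIdealCcq_measureKeys_twisted`), at distance at most `2 √(ε / 2) = √(2 ε)` from the measured
output. Comparing with `φ`, and not with a purification of the given private state, is what gives
this constant.

**Rates.** The tensor powers of `ψ` purify those of `ρ`, so both bounds apply to `n` copies, and
both error terms tend to zero with `ε`.
-/

namespace KeyDistill

/-! ### Unitary freedom and the polar decomposition -/

section TraceNorm

variable {m n : Type} [Fintype m] [Fintype n]

/-- Two matrices with the same Gram matrix differ by a unitary on the left. -/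
theorem exists_unitary_mul_eq [DecidableEq m] {X Y : Matrix m n ℂ} (h : Xᴴ * X = Yᴴ * Y) :
    ∃ U ∈ unitaryGroup m ℂ, U * X = Y := by
  classical
  let fX := toEuclideanLin X
  let fY := toEuclideanLin Y
  have hnorm : ∀ v, ‖fX v‖ = ‖fY v‖ := by
    have key : ∀ (Z : Matrix m n ℂ) v, ((‖toEuclideanLin Z v‖ ^ 2 : ℝ) : ℂ) =
        star v.ofLp ⬝ᵥ ((Zᴴ * Z) *ᵥ v.ofLp) := by
      intro Z v
      have := inner_self_eq_norm_sq_to_K (𝕜 := ℂ) (toEuclideanLin Z v)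
      rw [EuclideanSpace.inner_eq_star_dotProduct] at this
      push_cast
      rw [← mulVec_mulVec, dotProduct_mulVec, vecMul_conjTranspose, star_star, dotProduct_comm]
      exact this.symm
    intro v
    have : ((‖fX v‖ ^ 2 : ℝ) : ℂ) = ((‖fY v‖ ^ 2 : ℝ) : ℂ) := by
      rw [key, key, h]
    have h2 : ‖fX v‖ ^ 2 = ‖fY v‖ ^ 2 := by exact_mod_cast this
    exact (sq_eq_sq₀ (norm_nonneg _) (norm_nonneg _)).1 h2
  obtain ⟨g, hg⟩ := fX.rangeRestrict.exists_rightInverse_of_surjective fX.range_rangeRestrict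
  have hg' : ∀ r, fX (g r) = r := fun r => congrArg Subtype.val (LinearMap.congr_fun hg r)
  let L₀ : LinearMap.range fX →ₗᵢ[ℂ] EuclideanSpace ℂ m :=
    { toLinearMap := fY ∘ₗ g
      norm_map' := fun r => by
        change ‖fY (g r)‖ = ‖r‖
        rw [← hnorm, hg']; rfl }
  let L := L₀.extend
  have hL : ∀ v, L (fX v) = fY v := by
    intro v
    have h1 : L (fX v) = L₀ ⟨fX v, LinearMap.mem_range_self _ v⟩ :=
      L₀.extend_apply ⟨fX v, LinearMap.mem_range_self _ v⟩
    rw [h1]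
    change fY (g _) = fY v
    rw [← sub_eq_zero, ← map_sub, ← norm_eq_zero, ← hnorm, map_sub, hg', sub_self, norm_zero]
  refine ⟨of fun i j => (L (EuclideanSpace.single j 1)).ofLp i, ?_, ?_⟩
  · rw [mem_unitaryGroup_iff']
    ext i j
    have h1 := L.inner_map_map (EuclideanSpace.single i 1) (EuclideanSpace.single j 1)
    rw [EuclideanSpace.inner_eq_star_dotProduct] at h1
    rw [EuclideanSpace.inner_single_left] at h1
    simp only [star_eq_conjTranspose, mul_apply, conjTranspose_apply, of_apply]
    rw [dotProduct] at h1
    simp only [Pi.star_apply, mul_comm] at h1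
    rw [h1]
    simp [one_apply]
  · ext i j
    have h1 := congrArg (fun w => w.ofLp i) (hL (EuclideanSpace.single j 1))
    have h2 : fX (EuclideanSpace.single j 1) = ∑ k, X k j • EuclideanSpace.single k (1 : ℂ) := by
      ext k
      simp [fX, toEuclideanLin, Finset.sum_apply, Pi.single_apply]
    rw [h2, map_sum] at h1
    simp only [map_smul, WithLp.ofLp_sum, Finset.sum_apply, WithLp.ofLp_smul, Pi.smul_apply,
      smul_eq_mul] at h1
    rw [mul_apply]
    simp only [of_apply]
    rw [Finset.sum_congr rfl fun k _ => mul_comm _ _, h1]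
    simp [fY, toEuclideanLin]

theorem spectral_decomposition [DecidableEq n] {A : Matrix n n ℂ} (hA : A.IsHermitian) :
    ∃ V ∈ unitaryGroup n ℂ, A = V * diagonal (fun i => (hA.eigenvalues i : ℂ)) * Vᴴ :=
  ⟨hA.eigenvectorUnitary, hA.eigenvectorUnitary.2, by
    conv_lhs => rw [hA.spectral_theorem, Unitary.conjStarAlgAut_apply]
    rfl⟩

theorem exists_posSemidef_mul_self_eq [DecidableEq n] {A : Matrix n n ℂ} (hA : A.PosSemidef) :
    ∃ R : Matrix n n ℂ, R.PosSemidef ∧ R * R = A ∧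
      R.trace = ((∑ i, √(hA.1.eigenvalues i) : ℝ) : ℂ) := by
  obtain ⟨V, hV, hAV⟩ := spectral_decomposition hA.1
  have hV' : Vᴴ * V = 1 := mem_unitaryGroup_iff'.1 hV
  refine ⟨V * diagonal (fun i => ((√(hA.1.eigenvalues i) : ℝ) : ℂ)) * Vᴴ, ?_, ?_, ?_⟩
  · refine PosSemidef.mul_mul_conjTranspose_same (PosSemidef.diagonal fun i => ?_) V
    exact Complex.zero_le_real.2 (Real.sqrt_nonneg _)
  · conv_rhs => rw [hAV]
    have : ∀ D : Matrix n n ℂ, V * D * Vᴴ * (V * D * Vᴴ) = V * (D * D) * Vᴴ := fun D => by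
      calc V * D * Vᴴ * (V * D * Vᴴ) = V * D * (Vᴴ * V) * (D * Vᴴ) := by simp only [Matrix.mul_assoc]
        _ = _ := by rw [hV', Matrix.mul_one]; simp only [Matrix.mul_assoc]
    rw [this, diagonal_mul_diagonal]
    congr 3
    ext i
    rw [← Complex.ofReal_mul, Real.mul_self_sqrt (hA.eigenvalues_nonneg i)]
  · rw [trace_mul_comm, ← Matrix.mul_assoc, hV', Matrix.one_mul, trace_diagonal]
    push_cast; rfl

/-- The polar decomposition; the trace of the positive factor is the trace norm. -/
theorem exists_polar [DecidableEq n] (X : Matrix n n ℂ) :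
    ∃ U ∈ unitaryGroup n ℂ, ∃ R : Matrix n n ℂ, R.PosSemidef ∧ X = U * R ∧
      R.trace = (traceNorm X : ℂ) := by
  obtain ⟨R, hR, hRR, ht⟩ := @exists_posSemidef_mul_self_eq n _ (Classical.decEq n) _
    (posSemidef_conjTranspose_mul_self X)
  obtain ⟨U, hU, h⟩ := exists_unitary_mul_eq (X := R) (Y := X) (by rw [hR.1.eq, hRR])
  refine ⟨U, hU, R, hR, h.symm, ?_⟩
  rw [ht]
  rfl

theorem traceNorm_nonneg (X : Matrix n n ℂ) : 0 ≤ traceNorm X :=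
  Finset.sum_nonneg fun _ _ => Real.sqrt_nonneg _

/-- The trace norm is attained on some unitary. -/
theorem exists_unitary_trace_mul_eq_traceNorm [DecidableEq n] (X : Matrix n n ℂ) :
    ∃ H ∈ unitaryGroup n ℂ, (H * X).trace = (traceNorm X : ℂ) := by
  obtain ⟨U, hU, R, hR, h, ht⟩ := exists_polar X
  refine ⟨star U, Unitary.star_mem hU, ?_⟩
  conv_lhs => rw [h, ← Matrix.mul_assoc, mem_unitaryGroup_iff'.1 hU, Matrix.one_mul, ht]

theorem norm_trace_unitary_mul_le [DecidableEq n] {H : Matrix n n ℂ} (hH : H ∈ unitaryGroup n ℂ)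
    (X : Matrix n n ℂ) : ‖(H * X).trace‖ ≤ traceNorm X := by
  obtain ⟨U, hU, R, hR, h, ht⟩ := exists_polar X
  obtain ⟨V, hV, hRV⟩ := spectral_decomposition hR.1
  have hV' : Vᴴ * V = 1 := mem_unitaryGroup_iff'.1 hV
  set r := hR.1.eigenvalues
  have h0 : ∀ i, 0 ≤ r i := hR.eigenvalues_nonneg
  have htr : traceNorm X = ∑ i, r i := by
    have : (traceNorm X : ℂ) = ∑ i, (r i : ℂ) := by
      rw [← ht, hRV, trace_mul_comm, ← Matrix.mul_assoc, hV', Matrix.one_mul, trace_diagonal]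
    exact_mod_cast this
  have hW : Vᴴ * H * U * V ∈ unitaryGroup n ℂ :=
    mul_mem (mul_mem (mul_mem (Unitary.star_mem hV) hH) hU) hV
  have : (H * X).trace = ∑ i, (Vᴴ * H * U * V) i i * r i := by
    rw [h]
    conv_lhs => rw [hRV]
    rw [show H * (U * (V * diagonal (fun i => (r i : ℂ)) * Vᴴ)) =
      (H * U * V * diagonal (fun i => (r i : ℂ))) * Vᴴ by simp only [Matrix.mul_assoc],
      trace_mul_comm, trace]
    refine Finset.sum_congr rfl fun i _ => ?_
    rw [diag_apply, ← Matrix.mul_assoc, mul_diagonal]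
    simp only [Matrix.mul_assoc]
  rw [this, htr]
  refine (norm_sum_le _ _).trans (Finset.sum_le_sum fun i _ => ?_)
  rw [norm_mul, Complex.norm_real, Real.norm_of_nonneg (h0 i)]
  exact mul_le_of_le_one_left (h0 i) (entry_norm_bound_of_unitary hW i i)

/-- The trace norm does not increase under conjugation with a unitary. -/
theorem traceNorm_unitary_conj_le [DecidableEq n] {B : Matrix n n ℂ} (hB : B ∈ unitaryGroup n ℂ)
    (X : Matrix n n ℂ) : traceNorm (B * X * Bᴴ) ≤ traceNorm X := by
  obtain ⟨H, hH, h⟩ := exists_unitary_trace_mul_eq_traceNorm (B * X * Bᴴ)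
  have h1 : (H * (B * X * Bᴴ)).trace = ((Bᴴ * H * B) * X).trace := by
    rw [show H * (B * X * Bᴴ) = (H * B * X) * Bᴴ by simp only [Matrix.mul_assoc], trace_mul_comm]
    simp only [Matrix.mul_assoc]
  have h2 := norm_trace_unitary_mul_le (mul_mem (mul_mem (Unitary.star_mem hB) hH) hB) X
  rw [star_eq_conjTranspose, ← h1, h, Complex.norm_real] at h2
  exact (le_abs_self _).trans h2

/-! ### Overlaps and trace norm distances -/

/-- The entries of a matrix as a vector of a Euclidean space, which carries the
Hilbert-Schmidt inner product. -/
noncomputable def hsVec (M : Matrix m n ℂ) : EuclideanSpace ℂ (m × n) :=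
  WithLp.toLp 2 fun p => M p.1 p.2

theorem inner_hsVec (M N : Matrix m n ℂ) : inner ℂ (hsVec M) (hsVec N) = (Mᴴ * N).trace := by
  rw [EuclideanSpace.inner_eq_star_dotProduct, trace]
  simp only [hsVec, dotProduct, diag_apply, mul_apply, conjTranspose_apply, Pi.star_apply,
    Fintype.sum_prod_type]
  rw [Finset.sum_comm]
  exact Finset.sum_congr rfl fun _ _ => Finset.sum_congr rfl fun _ _ => mul_comm _ _

theorem norm_hsVec_sq (M : Matrix m n ℂ) : ‖hsVec M‖ ^ 2 = (Mᴴ * M).trace.re := by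
  rw [← inner_hsVec, ← inner_self_eq_norm_sq (𝕜 := ℂ)]
  rfl

theorem norm_hsVec_unitary_mul [DecidableEq m] {U : Matrix m m ℂ} (hU : U ∈ unitaryGroup m ℂ)
    (M : Matrix m n ℂ) : ‖hsVec (U * M)‖ = ‖hsVec M‖ := by
  rw [← sq_eq_sq₀ (norm_nonneg _) (norm_nonneg _), norm_hsVec_sq, norm_hsVec_sq,
    conjTranspose_mul, Matrix.mul_assoc, ← Matrix.mul_assoc Uᴴ, ← star_eq_conjTranspose U,
    mem_unitaryGroup_iff'.1 hU, Matrix.one_mul]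

/-- The trace norm distance of the reductions of two unit vectors is bounded by their overlap:
`M Mᴴ - N Nᴴ` is the Hermitian part of `(M - N) (M + N)ᴴ`, and the Cauchy-Schwarz inequality
applies. -/
theorem traceNorm_sub_le_of_overlap {M N : Matrix m n ℂ} (hM : (M * Mᴴ).trace = 1)
    (hN : (N * Nᴴ).trace = 1) :
    traceNorm (M * Mᴴ - N * Nᴴ) ≤ 2 * √(1 - (Mᴴ * N).trace.re ^ 2) := by
  classical
  obtain ⟨H, hH, h⟩ := exists_unitary_trace_mul_eq_traceNorm (M * Mᴴ - N * Nᴴ)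
  have hdec : (2 : ℂ) • (M * Mᴴ - N * Nᴴ) = (M - N) * (M + N)ᴴ + (M + N) * (M - N)ᴴ := by
    rw [conjTranspose_add, conjTranspose_sub, two_smul]
    simp only [Matrix.mul_add, Matrix.mul_sub, Matrix.sub_mul, Matrix.add_mul]
    abel
  have hcs : ∀ P Q : Matrix m n ℂ, ‖(H * (P * Qᴴ)).trace‖ ≤ ‖hsVec P‖ * ‖hsVec Q‖ := by
    intro P Q
    rw [← Matrix.mul_assoc, trace_mul_comm, ← inner_hsVec, mul_comm]
    rw [← norm_hsVec_unitary_mul hH P]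
    exact norm_inner_le_norm _ _
  have hsum : 2 * traceNorm (M * Mᴴ - N * Nᴴ) ≤ 2 * (‖hsVec (M - N)‖ * ‖hsVec (M + N)‖) := by
    have h1 : ((2 * traceNorm (M * Mᴴ - N * Nᴴ) : ℝ) : ℂ) =
        (H * ((M - N) * (M + N)ᴴ)).trace + (H * ((M + N) * (M - N)ᴴ)).trace := by
      rw [← trace_add, ← Matrix.mul_add, ← hdec, Matrix.mul_smul, trace_smul, h]
      push_cast; rfl
    have h2 := norm_add_le (H * ((M - N) * (M + N)ᴴ)).trace (H * ((M + N) * (M - N)ᴴ)).trace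
    rw [← h1, Complex.norm_real] at h2
    have h3 := hcs (M - N) (M + N)
    have h4 := hcs (M + N) (M - N)
    have h5 := le_abs_self (2 * traceNorm (M * Mᴴ - N * Nᴴ))
    rw [Real.norm_eq_abs] at h2
    linarith [mul_comm ‖hsVec (M + N)‖ ‖hsVec (M - N)‖]
  have hMn : ‖hsVec M‖ ^ 2 = 1 := by rw [norm_hsVec_sq, trace_mul_comm, hM]; rfl
  have hNn : ‖hsVec N‖ ^ 2 = 1 := by rw [norm_hsVec_sq, trace_mul_comm, hN]; rfl
  have hc : (Mᴴ * N).trace.re = RCLike.re (inner ℂ (hsVec M) (hsVec N)) := by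
    rw [inner_hsVec]; rfl
  have hadd : ‖hsVec (M + N)‖ ^ 2 = 2 + 2 * (Mᴴ * N).trace.re := by
    have : hsVec (M + N) = hsVec M + hsVec N := rfl
    rw [this, norm_add_sq (𝕜 := ℂ), hMn, hNn, hc]; ring
  have hsub : ‖hsVec (M - N)‖ ^ 2 = 2 - 2 * (Mᴴ * N).trace.re := by
    have : hsVec (M - N) = hsVec M - hsVec N := rfl
    rw [this, norm_sub_sq (𝕜 := ℂ), hMn, hNn, hc]; ring
  have : traceNorm (M * Mᴴ - N * Nᴴ) ^ 2 ≤ 4 * (1 - (Mᴴ * N).trace.re ^ 2) := by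
    calc _ ≤ (‖hsVec (M - N)‖ * ‖hsVec (M + N)‖) ^ 2 :=
          pow_le_pow_left₀ (traceNorm_nonneg _) (by linarith) 2
      _ = _ := by rw [mul_pow, hadd, hsub]; ring
  calc _ ≤ √(4 * (1 - (Mᴴ * N).trace.re ^ 2)) := Real.le_sqrt_of_sq_le this
    _ = _ := by
      rw [Real.sqrt_mul (by norm_num), show (4 : ℝ) = 2 ^ 2 by norm_num,
        Real.sqrt_sq (by norm_num)]

theorem trace_mul_nonneg_of_posSemidef {P Q : Matrix n n ℂ} (hP : P.PosSemidef) (hQ : Q.PosSemidef) :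
    0 ≤ (P * Q).trace := by
  classical
  obtain ⟨R, hR, hRR, -⟩ := exists_posSemidef_mul_self_eq hP
  rw [← hRR, Matrix.mul_assoc, trace_mul_comm]
  have := (hQ.mul_mul_conjTranspose_same R).trace_nonneg
  rwa [hR.1.eq] at this

/-- The Powers-Størmer inequality: test `R ^ 2 - S ^ 2` against the sign of `R - S`. -/
theorem trace_sub_mul_self_le_traceNorm {R S : Matrix n n ℂ} (hR : R.PosSemidef)
    (hS : S.PosSemidef) : ((R - S) * (R - S)).trace.re ≤ traceNorm (R * R - S * S) := by
  classical
  have hD : (R - S).IsHermitian := hR.1.sub hS.1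
  obtain ⟨V, hV, hDV⟩ := spectral_decomposition hD
  have hV' : Vᴴ * V = 1 := mem_unitaryGroup_iff'.1 hV
  set r := hD.eigenvalues
  set D := R - S
  -- The sign of `0` is taken to be `1`, so that the sign of `D` is unitary.
  let s : n → ℂ := fun i => if 0 ≤ r i then 1 else -1
  let H : Matrix n n ℂ := V * diagonal s * Vᴴ
  let T : Matrix n n ℂ := V * diagonal (fun i => ((|r i| : ℝ) : ℂ)) * Vᴴ
  have hprod : ∀ a b : n → ℂ, (V * diagonal a * Vᴴ) * (V * diagonal b * Vᴴ) =
      V * diagonal (fun i => a i * b i) * Vᴴ := fun a b => by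
    calc V * diagonal a * Vᴴ * (V * diagonal b * Vᴴ)
        = V * diagonal a * (Vᴴ * V) * (diagonal b * Vᴴ) := by simp only [Matrix.mul_assoc]
      _ = V * (diagonal a * diagonal b) * Vᴴ := by
        rw [hV', Matrix.mul_one]; simp only [Matrix.mul_assoc]
      _ = _ := by rw [diagonal_mul_diagonal]
  have hs : ∀ i, s i * r i = ((|r i| : ℝ) : ℂ) := fun i => by
    by_cases h : 0 ≤ r i
    · simp [s, h, abs_of_nonneg h]
    · simp [s, h, abs_of_neg (not_le.1 h)]
  have hHD : H * D = T := by
    rw [hDV, hprod]; simp only [hs]; rfl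
  have hDH : D * H = T := by
    rw [hDV, hprod]; simp only [mul_comm _ (s _), hs]; rfl
  have hHu : H ∈ unitaryGroup n ℂ := by
    refine mul_mem (mul_mem hV ?_) (Unitary.star_mem hV)
    rw [mem_unitaryGroup_iff, star_eq_conjTranspose, diagonal_conjTranspose, diagonal_mul_diagonal,
      ← diagonal_one]
    congr 1; ext i
    by_cases h : 0 ≤ r i <;> simp [s, h]
  have hTm : (T - D).PosSemidef := by
    rw [hDV, ← Matrix.sub_mul, ← Matrix.mul_sub, diagonal_sub]
    refine PosSemidef.mul_mul_conjTranspose_same (PosSemidef.diagonal fun i => ?_) V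
    rw [Pi.zero_apply, ← Complex.ofReal_sub]
    exact Complex.zero_le_real.2 (sub_nonneg.2 (le_abs_self (r i)))
  have hTp : (T + D).PosSemidef := by
    rw [hDV, ← Matrix.add_mul, ← Matrix.mul_add, diagonal_add]
    refine PosSemidef.mul_mul_conjTranspose_same (PosSemidef.diagonal fun i => ?_) V
    rw [Pi.zero_apply, ← Complex.ofReal_add]
    have := neg_abs_le (r i)
    exact Complex.zero_le_real.2 (by linarith)
  have h1 : (H * (R * R - S * S)).trace = (T * (R + S)).trace := by
    have e : (2 : ℂ) • (R * R - S * S) = D * (R + S) + (R + S) * D := by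
      simp only [D, two_smul, Matrix.mul_add, Matrix.mul_sub, Matrix.sub_mul, Matrix.add_mul]
      abel
    have e2 : 2 * (H * (R * R - S * S)).trace = 2 * (T * (R + S)).trace := by
      rw [← smul_eq_mul, ← trace_smul, ← Matrix.mul_smul, e, Matrix.mul_add, trace_add,
        ← Matrix.mul_assoc, hHD, trace_mul_comm H, Matrix.mul_assoc (R + S), hDH, trace_mul_comm _ T,
        two_mul]
    exact mul_left_cancel₀ two_ne_zero e2
  have h2 : (T * (R + S)).trace = (D * D).trace + (((T - D) * R).trace + ((T + D) * S).trace) := by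
    rw [← trace_add, ← trace_add]
    congr 1
    conv_rhs => enter [1, 2]; simp only [D]
    simp only [Matrix.mul_add, Matrix.mul_sub, Matrix.sub_mul, Matrix.add_mul]
    abel
  have h3 := (Complex.le_def.1 (trace_mul_nonneg_of_posSemidef hTm hR)).1
  have h4 := (Complex.le_def.1 (trace_mul_nonneg_of_posSemidef hTp hS)).1
  have h5 := (Complex.re_le_norm _).trans (norm_trace_unitary_mul_le hHu (R * R - S * S))
  rw [h1, h2] at h5
  simp only [Complex.add_re, Complex.zero_re] at h3 h4 h5
  linarith

/-- A vector with reduction close to `β` is close to a purification of `β`: Uhlmann's theorem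
together with the bound of the fidelity by the trace norm distance. The embedding `w` says that
the purifying system is large enough. -/
theorem exists_purification_overlap [DecidableEq n] (Ψ : Matrix n m ℂ)
    (w : n ↪ m) {β : Matrix n n ℂ} (hβ : IsState β) (hΨ : (Ψ * Ψᴴ).trace = 1) :
    ∃ Φ : Matrix n m ℂ, Φ * Φᴴ = β ∧
      1 - traceNorm (Ψ * Ψᴴ - β) / 2 ≤ (Ψᴴ * Φ).trace.re := by
  classical
  obtain ⟨R, hR, hRR, -⟩ := exists_posSemidef_mul_self_eq (posSemidef_self_mul_conjTranspose Ψ)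
  obtain ⟨S, hS, hSS, -⟩ := exists_posSemidef_mul_self_eq hβ.1
  let W : Matrix n m ℂ := of fun i j => if w i = j then 1 else 0
  have hW : W * Wᴴ = 1 := by
    ext i j
    simp [W, mul_apply, one_apply, eq_comm]
  have hiso : ∀ Q : Matrix n n ℂ, Q.IsHermitian → (Q * W) * (Q * W)ᴴ = Q * Q := fun Q hQ => by
    rw [conjTranspose_mul, hQ.eq, Matrix.mul_assoc, ← Matrix.mul_assoc W, hW, Matrix.one_mul]
  obtain ⟨U, hU, hUΨ⟩ := exists_unitary_mul_eq (X := (R * W)ᴴ) (Y := Ψᴴ) (by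
    rw [conjTranspose_conjTranspose, conjTranspose_conjTranspose, hiso R hR.1, hRR])
  have hU' : Uᴴ * U = 1 := mem_unitaryGroup_iff'.1 hU
  refine ⟨S * W * Uᴴ, ?_, ?_⟩
  · rw [conjTranspose_mul, conjTranspose_conjTranspose, Matrix.mul_assoc, ← Matrix.mul_assoc Uᴴ,
      hU', Matrix.one_mul, hiso S hS.1, hSS]
  · have h1 : (Ψᴴ * (S * W * Uᴴ)).trace = (R * S).trace := by
      rw [← hUΨ, ← Matrix.mul_assoc, trace_mul_comm, ← Matrix.mul_assoc, ← Matrix.mul_assoc,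
        ← Matrix.mul_assoc Uᴴ, hU', Matrix.one_mul, conjTranspose_mul, hR.1.eq, trace_mul_comm,
        Matrix.mul_assoc Wᴴ, ← Matrix.mul_assoc W, hW, Matrix.one_mul]
    have h2 := trace_sub_mul_self_le_traceNorm hR hS
    have h3 : ((R - S) * (R - S)).trace = 2 - 2 * (R * S).trace := by
      simp only [Matrix.mul_sub, Matrix.sub_mul, trace_sub, hRR, hSS, hΨ, hβ.2,
        trace_mul_comm S R]
      ring
    rw [h3, hRR, hSS] at h2
    rw [h1]
    simp only [Complex.sub_re, Complex.mul_re, Complex.re_ofNat, Complex.im_ofNat, zero_mul,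
      sub_zero] at h2
    linarith

end TraceNorm

/-! ### Kraus maps and elementary LOCC operations -/

section Kraus

variable {κ A A' B B' E F : Type}

theorem krausMap_mul_conjTranspose [Fintype κ] [Fintype A] [Fintype F] (K : κ → Matrix A' A ℂ)
    (M : Matrix A F ℂ) : krausMap K (M * Mᴴ) = ∑ k, (K k * M) * (K k * M)ᴴ := by
  simp only [krausMap, conjTranspose_mul, Matrix.mul_assoc]

theorem krausMap_mul_conjTranspose_apply [Fintype κ] [Fintype A] [Fintype F]
    (K : κ → Matrix A' A ℂ) (M : Matrix A F ℂ) (x y : A') :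
    krausMap K (M * Mᴴ) x y = ∑ k, ∑ f, (K k * M) x f * star ((K k * M) y f) := by
  rw [krausMap_mul_conjTranspose, Matrix.sum_apply]
  exact Finset.sum_congr rfl fun k _ => mul_apply

theorem kronecker_one_mul_apply [Fintype A] [Fintype B] [DecidableEq B] (K : Matrix A' A ℂ)
    (M : Matrix (A × B) F ℂ) (x : A' × B) (f : F) :
    ((K ⊗ₖ (1 : Matrix B B ℂ)) * M) x f = ∑ a, K x.1 a * M (a, x.2) f := by
  simp [mul_apply, Fintype.sum_prod_type, kroneckerMap_apply, one_apply]

theorem one_kronecker_mul_apply [Fintype A] [Fintype B] [DecidableEq A] (K : Matrix B' B ℂ)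
    (M : Matrix (A × B) F ℂ) (x : A × B') (f : F) :
    (((1 : Matrix A A ℂ) ⊗ₖ K) * M) x f = ∑ b, K x.2 b * M (x.1, b) f := by
  simp [mul_apply, Fintype.sum_prod_type, kroneckerMap_apply, one_apply]

theorem kronecker_one_conj_apply [Fintype A] [Fintype B] [DecidableEq B] (K : Matrix A' A ℂ)
    (X : Matrix (A × B) (A × B) ℂ) (x y : A' × B) :
    ((K ⊗ₖ (1 : Matrix B B ℂ)) * X * (K ⊗ₖ (1 : Matrix B B ℂ))ᴴ) x y =
      ∑ a, ∑ a₂, K x.1 a * X (a, x.2) (a₂, y.2) * star (K y.1 a₂) := by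
  rw [Matrix.mul_assoc, kronecker_one_mul_apply]
  refine Finset.sum_congr rfl fun a _ => ?_
  rw [← conjTranspose_conjTranspose X, ← conjTranspose_mul, conjTranspose_apply,
    kronecker_one_mul_apply, star_sum, Finset.mul_sum]
  simp [mul_assoc, mul_comm]

theorem one_kronecker_conj_apply [Fintype A] [Fintype B] [DecidableEq A] (K : Matrix B' B ℂ)
    (X : Matrix (A × B) (A × B) ℂ) (x y : A × B') :
    (((1 : Matrix A A ℂ) ⊗ₖ K) * X * ((1 : Matrix A A ℂ) ⊗ₖ K)ᴴ) x y =
      ∑ b, ∑ b₂, K x.2 b * X (x.1, b) (y.1, b₂) * star (K y.2 b₂) := by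
  rw [Matrix.mul_assoc, one_kronecker_mul_apply]
  refine Finset.sum_congr rfl fun a _ => ?_
  rw [← conjTranspose_conjTranspose X, ← conjTranspose_mul, conjTranspose_apply,
    one_kronecker_mul_apply, star_sum, Finset.mul_sum]
  simp [mul_assoc, mul_comm]

/-- The isometry `|a⟩ ↦ |f a⟩` of an injective map `f` is a single Kraus operator. -/
theorem isKraus_of_leftInverse [Fintype A] [Fintype A'] [DecidableEq A'] {f : A → A'} {g : A' → A}
    (h : Function.LeftInverse g f) :
    IsKraus fun _ : Unit => (of fun a' a => if f a = a' then 1 else 0 : Matrix A' A ℂ) := by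
  classical
  ext a a₂
  simp [mul_apply, one_apply, h.injective.eq_iff, eq_comm]

theorem sum_sum_ite_eq_of_leftInverse [Fintype A] [DecidableEq A'] {f : A → A'} {g : A' → A}
    (h : Function.LeftInverse g f) (Y : A → A → ℂ) (x y : A') :
    (∑ a, ∑ a₂, (if f a = x then 1 else 0) * Y a a₂ * star (if f a₂ = y then (1 : ℂ) else 0)) =
      if f (g x) = x ∧ f (g y) = y then Y (g x) (g y) else 0 := by
  classical
  have hf : ∀ {z}, f (g z) = z → ∀ a, f a = z ↔ a = g z := fun hz a =>
    ⟨fun e => by rw [← e, h a], fun e => e ▸ hz⟩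
  have hf' : ∀ {z}, f (g z) ≠ z → ∀ a, f a ≠ z := fun hz a e => hz (by rw [← e, h a])
  by_cases hx : f (g x) = x
  · by_cases hy : f (g y) = y
    · simp [hf hx, hf hy, hx, hy, apply_ite star]
    · simp [hf' hy]
  · simp [hf' hx]

/-- Alice applies the isometry `|a⟩ ↦ |f a⟩` of a map `f` with left inverse `g`. -/
theorem IsLOCC.embed_alice [Fintype A] [Fintype A'] [Fintype B] [DecidableEq A']
    {f : A → A'} {g : A' → A} (h : Function.LeftInverse g f) :
    IsLOCC fun X : Matrix (A × B) (A × B) ℂ => (of fun x y =>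
      if f (g x.1) = x.1 ∧ f (g y.1) = y.1 then X (g x.1, x.2) (g y.1, y.2) else 0 :
        Matrix (A' × B) (A' × B) ℂ) := by
  classical
  convert IsLOCC.alice (B := B) _ (isKraus_of_leftInverse h) using 1
  funext X
  ext x y
  rw [krausMap, Finset.univ_unique, Finset.sum_singleton, kronecker_one_conj_apply]
  exact (sum_sum_ite_eq_of_leftInverse h (fun a a₂ => X (a, x.2) (a₂, y.2)) x.1 y.1).symm

/-- Bob applies the isometry `|b⟩ ↦ |f b⟩` of a map `f` with left inverse `g`. -/
theorem IsLOCC.embed_bob [Fintype A] [Fintype B] [Fintype B'] [DecidableEq B']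
    {f : B → B'} {g : B' → B} (h : Function.LeftInverse g f) :
    IsLOCC fun X : Matrix (A × B) (A × B) ℂ => (of fun x y =>
      if f (g x.2) = x.2 ∧ f (g y.2) = y.2 then X (x.1, g x.2) (y.1, g y.2) else 0 :
        Matrix (A × B') (A × B') ℂ) := by
  classical
  convert IsLOCC.bob (A := A) _ (isKraus_of_leftInverse h) using 1
  funext X
  ext x y
  rw [krausMap, Finset.univ_unique, Finset.sum_singleton, one_kronecker_conj_apply]
  exact (sum_sum_ite_eq_of_leftInverse h (fun b b₂ => X (x.1, b) (y.1, b₂)) x.2 y.2).symm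

theorem IsLOCC.relabel [Fintype A] [Fintype A'] [Fintype B] [Fintype B'] (e : A' ≃ A)
    (f : B' ≃ B) :
    IsLOCC fun X : Matrix (A × B) (A × B) ℂ => X.submatrix (Prod.map e f) (Prod.map e f) := by
  classical
  convert (IsLOCC.embed_alice (B := B) e.right_inv).comp
    (IsLOCC.embed_bob (A := A') f.right_inv) using 1
  funext X
  ext x y
  simp [Prod.map]

/-- All Kraus operators of a channel applied at once, their labels kept in a new register `κ`:
the Stinespring isometry, with a further register `S` left alone. -/
theorem IsKraus.dilation [Fintype κ] [Fintype A] [Fintype A'] {S : Type} [Fintype S]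
    [DecidableEq S] {K : κ → Matrix A' A ℂ} (hK : IsKraus K) :
    IsKraus fun _ : Unit => (of fun x y => if x.2.2 = y.2 then K x.2.1 x.1 y.1 else 0 :
      Matrix (A' × (κ × S)) (A × S) ℂ) := by
  classical
  ext ⟨a, s⟩ ⟨a₂, s₂⟩
  have h1 := congrFun (congrFun hK a) a₂
  simp only [Matrix.sum_apply, mul_apply, conjTranspose_apply] at h1
  rw [Finset.sum_comm] at h1
  simp only [Finset.univ_unique, Finset.sum_singleton, mul_apply, conjTranspose_apply,
    of_apply, Fintype.sum_prod_type]
  by_cases hs : s = s₂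
  · subst hs
    simp only [apply_ite star, star_zero, mul_ite, ite_mul, zero_mul, mul_zero, Finset.sum_ite_eq',
      Finset.mem_univ, if_true, h1]
    simp [one_apply]
  · simp [apply_ite star, one_apply, hs, Ne.symm hs]

end Kraus

/-! ### Coherent simulation of public communication -/

section Shield

variable {A B E S T : Type}

theorem traceE_pureState_eq [Fintype E] (ψ : A × B × E → ℂ) :
    traceE (pureState ψ) = (of fun (x : A × B) e => ψ (x.1, x.2, e) : Matrix (A × B) E ℂ) *
      (of fun (x : A × B) e => ψ (x.1, x.2, e) : Matrix (A × B) E ℂ)ᴴ := by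
  ext x y
  simp [traceE, pureState, vecMulVec_apply, mul_apply]

/-- The operator on `ABE` obtained from the vector `ψ` by tracing out the shield systems `S` of
Alice and `T` of Bob. -/
noncomputable def traceShield [Fintype S] [Fintype T] (ψ : (A × S) × (B × T) × E → ℂ) :
    Matrix (A × B × E) (A × B × E) ℂ :=
  of fun x y => ∑ s, ∑ t, ψ ((x.1, s), (x.2.1, t), x.2.2) * star (ψ ((y.1, s), (y.2.1, t), y.2.2))

theorem traceShield_eq [Fintype S] [Fintype T] (ψ : (A × S) × (B × T) × E → ℂ) :
    traceShield ψ =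
      (of fun x z => ψ ((x.1, z.1), (x.2.1, z.2), x.2.2) : Matrix (A × B × E) (S × T) ℂ) *
      (of fun x z => ψ ((x.1, z.1), (x.2.1, z.2), x.2.2) : Matrix (A × B × E) (S × T) ℂ)ᴴ := by
  ext x y
  simp [traceShield, mul_apply, Fintype.sum_prod_type]

end Shield

/-- Every LOPC operation has a coherent version: Alice and Bob keep the environments of their
channels, and a copy of each message they send, in the shields `S'` and `T'`. Started on a pure
state, the coherent version ends in a pure state `ψ'`. Tracing out the shields recovers the LOPC
operation, and tracing out Eve leaves an LOCC operation. -/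
theorem IsLOPC.exists_coherent {A B E A' B' E' : Type}
    {Λ : Matrix (A × B × E) (A × B × E) ℂ → Matrix (A' × B' × E') (A' × B' × E') ℂ}
    (h : IsLOPC Λ) : ∀ (S T : Type) [Fintype S] [Fintype T] [Fintype E]
      (ψ : (A × S) × (B × T) × E → ℂ),
    ∃ (S' T' : Type) (_ : Fintype S') (_ : Fintype T') (_ : Fintype E')
      (ψ' : (A' × S') × (B' × T') × E' → ℂ)
      (Λ' : Matrix ((A × S) × (B × T)) ((A × S) × (B × T)) ℂ →
        Matrix ((A' × S') × (B' × T')) ((A' × S') × (B' × T')) ℂ),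
      IsLOCC Λ' ∧ Λ' (traceE (pureState ψ)) = traceE (pureState ψ') ∧
        Λ (traceShield ψ) = traceShield ψ' := by
  classical
  induction h with
  | refl =>
    intro S T _ _ _ ψ
    exact ⟨S, T, inferInstance, inferInstance, inferInstance, ψ, id, IsLOCC.refl, rfl, rfl⟩
  | comp _ _ ih ih' =>
    intro S T _ _ _ ψ
    obtain ⟨S', T', _, _, _, ψ', Λ', hΛ', h1, h2⟩ := ih S T ψ
    obtain ⟨S'', T'', i1, i2, i3, ψ'', Λ'', hΛ'', h3, h4⟩ := ih' S' T' ψ'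
    exact ⟨S'', T'', i1, i2, i3, ψ'', Λ'' ∘ Λ', hΛ'.comp hΛ'', by simp [h1, h3], by simp [h2, h4]⟩
  | @alice κ A A' B E _ _ _ _ iE' _ _ K hK =>
    intro S T _ _ iE ψ
    cases Subsingleton.elim iE iE'
    refine ⟨κ × S, T, inferInstance, inferInstance, inferInstance,
      fun z => ∑ a, K z.1.2.1 z.1.1 a * ψ ((a, z.1.2.2), z.2),
      krausMap fun _ : Unit => (of fun x y => if x.2.2 = y.2 then K x.2.1 x.1 y.1 else 0 :
        Matrix (A' × (κ × S)) (A × S) ℂ) ⊗ₖ (1 : Matrix (B × T) (B × T) ℂ),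
      IsLOCC.alice _ hK.dilation, ?_, ?_⟩
    · rw [traceE_pureState_eq, traceE_pureState_eq, krausMap_mul_conjTranspose]
      simp only [Finset.univ_unique, Finset.sum_singleton]
      have : ∀ P Q : Matrix ((A' × (κ × S)) × (B × T)) E ℂ, P = Q → P * Pᴴ = Q * Qᴴ :=
        fun P Q h => by rw [h]
      apply this
      ext x e
      rw [kronecker_one_mul_apply]
      simp [Fintype.sum_prod_type]
    · rw [traceShield_eq]
      ext x y
      rw [krausMap_mul_conjTranspose_apply]
      simp only [one_kronecker_one, kronecker_one_mul_apply]
      simp [traceShield, Fintype.sum_prod_type]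
  | @bob κ A B B' E _ _ _ _ iE' _ _ K hK =>
    intro S T _ _ iE ψ
    cases Subsingleton.elim iE iE'
    refine ⟨S, κ × T, inferInstance, inferInstance, inferInstance,
      fun z => ∑ b, K z.2.1.2.1 z.2.1.1 b * ψ (z.1, (b, z.2.1.2.2), z.2.2),
      krausMap fun _ : Unit => (1 : Matrix (A × S) (A × S) ℂ) ⊗ₖ
        (of fun x y => if x.2.2 = y.2 then K x.2.1 x.1 y.1 else 0 :
        Matrix (B' × (κ × T)) (B × T) ℂ),
      IsLOCC.bob _ hK.dilation, ?_, ?_⟩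
    · rw [traceE_pureState_eq, traceE_pureState_eq, krausMap_mul_conjTranspose]
      simp only [Finset.univ_unique, Finset.sum_singleton]
      have : ∀ P Q : Matrix ((A × S) × (B' × (κ × T))) E ℂ, P = Q → P * Pᴴ = Q * Qᴴ :=
        fun P Q h => by rw [h]
      apply this
      ext x e
      rw [one_kronecker_mul_apply]
      simp [Fintype.sum_prod_type]
    · rw [traceShield_eq]
      ext x y
      rw [krausMap_mul_conjTranspose_apply]
      simp only [one_kronecker_mul_apply, Fintype.sum_prod_type, kroneckerMap_apply, one_apply,
        traceShield]
      rw [Finset.sum_comm]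
      simp
  | @sendAB x A B E _ _ _ _ _ =>
    intro S T _ _ iE ψ
    refine ⟨x × S, T, inferInstance, inferInstance, inferInstance,
      fun z => if z.1.1.1 = z.1.2.1 ∧ z.1.1.1 = z.2.1.1.1 ∧ z.1.1.1 = z.2.2.1 then
        ψ (((z.1.1.1, z.1.1.2), z.1.2.2), (z.2.1.1.2, z.2.1.2), z.2.2.2) else 0,
      _, ((IsLOCC.embed_alice (A := (x × A) × S) (A' := x × (A × (x × S))) (B := B × T)
        (f := fun z => (z.1.1, (z.1.2, (z.1.1, z.2)))) (g := fun z => ((z.1, z.2.1), z.2.2.2))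
        fun z => rfl).comp IsLOCC.sendAB).comp
        (IsLOCC.relabel (A' := (x × A) × (x × S)) (B' := (x × B) × T)
          (Equiv.prodAssoc _ _ _) (Equiv.prodAssoc _ _ _)), ?_, ?_⟩
    · ext ⟨⟨⟨i, a⟩, ⟨i₂, s⟩⟩, ⟨⟨j, b⟩, t⟩⟩ ⟨⟨⟨i', a'⟩, ⟨i₂', s'⟩⟩, ⟨⟨j', b'⟩, t'⟩⟩
      by_cases h : i = i' ∧ i = j ∧ i = j' ∧ i = i₂ ∧ i = i₂'
      · obtain ⟨rfl, rfl, rfl, rfl, rfl⟩ := h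
        simp [traceE, pureState, vecMulVec_apply, classicalAB, Fintype.sum_prod_type,
          ite_and]
      · refine Eq.trans ?_ (Finset.sum_eq_zero ?_).symm
        · by_cases h1 : i = i' ∧ i = j ∧ i = j'
          · obtain ⟨rfl, rfl, rfl⟩ := h1
            have h2 : ¬ (i = i₂ ∧ i = i₂') := fun h2 => h ⟨rfl, rfl, rfl, h2⟩
            simp only [classicalAB, Function.comp_apply]
            simpa using fun e1 e2 => absurd ⟨e1, e2⟩ h2
          · simp [classicalAB, h1]
        · rintro ⟨k, e⟩ -
          simp only [pureState, vecMulVec_apply, Pi.star_apply]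
          by_cases h1 : i = i₂ ∧ i = j ∧ i = k
          · by_cases h2 : i' = i₂' ∧ i' = j' ∧ i' = k
            · exact absurd ⟨h1.2.2.trans h2.2.2.symm, h1.2.1,
                h1.2.2.trans (h2.2.2.symm.trans h2.2.1), h1.1,
                h1.2.2.trans (h2.2.2.symm.trans h2.1)⟩ h
            · simp [h2]
          · simp [h1]
    · ext ⟨⟨i, a⟩, ⟨j, b⟩, ⟨k, e⟩⟩ ⟨⟨i', a'⟩, ⟨j', b'⟩, ⟨k', e'⟩⟩
      by_cases h : i = i' ∧ i = j ∧ i = j' ∧ i = k ∧ i = k'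
      · obtain ⟨rfl, rfl, rfl, rfl, rfl⟩ := h
        simp [traceShield, publicAB, Fintype.sum_prod_type, ite_and]
      · refine Eq.trans (by simp [publicAB, h]) (Finset.sum_eq_zero fun z _ => ?_).symm
        refine Finset.sum_eq_zero fun t _ => ?_
        by_cases h1 : i = z.1 ∧ i = j ∧ i = k
        · by_cases h2 : i' = z.1 ∧ i' = j' ∧ i' = k'
          · exact absurd ⟨h1.1.trans h2.1.symm, h1.2.1, h1.1.trans (h2.1.symm.trans h2.2.1),
              h1.2.2, h1.1.trans (h2.1.symm.trans h2.2.2)⟩ h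
          · simp [h2]
        · simp [h1]
  | @sendBA x A B E _ _ _ _ _ =>
    intro S T _ _ iE ψ
    refine ⟨S, x × T, inferInstance, inferInstance, inferInstance,
      fun z => if z.2.1.1.1 = z.2.1.2.1 ∧ z.2.1.1.1 = z.1.1.1 ∧ z.2.1.1.1 = z.2.2.1 then
        ψ ((z.1.1.2, z.1.2), ((z.2.1.1.1, z.2.1.1.2), z.2.1.2.2), z.2.2.2) else 0,
      _, ((IsLOCC.embed_bob (A := A × S) (B := (x × B) × T) (B' := x × (B × (x × T)))
        (f := fun z => (z.1.1, (z.1.2, (z.1.1, z.2)))) (g := fun z => ((z.1, z.2.1), z.2.2.2))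
        fun z => rfl).comp IsLOCC.sendBA).comp
        (IsLOCC.relabel (A' := (x × A) × S) (B' := (x × B) × (x × T))
          (Equiv.prodAssoc _ _ _) (Equiv.prodAssoc _ _ _)), ?_, ?_⟩
    · ext ⟨⟨⟨j, a⟩, s⟩, ⟨⟨i, b⟩, ⟨i₂, t⟩⟩⟩ ⟨⟨⟨j', a'⟩, s'⟩, ⟨⟨i', b'⟩, ⟨i₂', t'⟩⟩⟩
      by_cases h : i = i' ∧ i = j ∧ i = j' ∧ i = i₂ ∧ i = i₂'
      · obtain ⟨rfl, rfl, rfl, rfl, rfl⟩ := h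
        simp [traceE, pureState, vecMulVec_apply, classicalBA, Fintype.sum_prod_type,
          ite_and]
      · refine Eq.trans ?_ (Finset.sum_eq_zero ?_).symm
        · by_cases h1 : i = i' ∧ i = j ∧ i = j'
          · obtain ⟨rfl, rfl, rfl⟩ := h1
            have h2 : ¬ (i = i₂ ∧ i = i₂') := fun h2 => h ⟨rfl, rfl, rfl, h2⟩
            simp only [classicalBA, Function.comp_apply]
            simpa using fun e1 e2 => absurd ⟨e1, e2⟩ h2
          · simp [classicalBA, h1]
        · rintro ⟨k, e⟩ -
          simp only [pureState, vecMulVec_apply, Pi.star_apply]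
          by_cases h1 : i = i₂ ∧ i = j ∧ i = k
          · by_cases h2 : i' = i₂' ∧ i' = j' ∧ i' = k
            · exact absurd ⟨h1.2.2.trans h2.2.2.symm, h1.2.1,
                h1.2.2.trans (h2.2.2.symm.trans h2.2.1), h1.1,
                h1.2.2.trans (h2.2.2.symm.trans h2.1)⟩ h
            · simp [h2]
          · simp [h1]
    · ext ⟨⟨j, a⟩, ⟨i, b⟩, ⟨k, e⟩⟩ ⟨⟨j', a'⟩, ⟨i', b'⟩, ⟨k', e'⟩⟩
      by_cases h : i = i' ∧ i = j ∧ i = j' ∧ i = k ∧ i = k'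
      · obtain ⟨rfl, rfl, rfl, rfl, rfl⟩ := h
        simp [traceShield, publicBA, Fintype.sum_prod_type, ite_and]
      · refine Eq.trans (by simp [publicBA, h]) (Finset.sum_eq_zero fun s _ => ?_).symm
        refine Finset.sum_eq_zero fun z _ => ?_
        by_cases h1 : i = z.1 ∧ i = j ∧ i = k
        · by_cases h2 : i' = z.1 ∧ i' = j' ∧ i' = k'
          · exact absurd ⟨h1.1.trans h2.1.symm, h1.2.1, h1.1.trans (h2.1.symm.trans h2.2.1),
              h1.2.2, h1.1.trans (h2.1.symm.trans h2.2.2)⟩ h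
          · simp [h2]
        · simp [h1]

/-! ### Entries of ccq states and of private states -/

section Entries

variable {d : ℕ} {E S T : Type}

theorem keyTensor_apply (i j : Fin d) (σ : Matrix E E ℂ) (x y : Fin d × Fin d × E) :
    keyTensor i j σ x y =
      if x.1 = i ∧ x.2.1 = j ∧ y.1 = i ∧ y.2.1 = j then σ x.2.2 y.2.2 else 0 := by
  by_cases h1 : x.1 = i <;> by_cases h2 : x.2.1 = j <;> by_cases h3 : y.1 = i <;>
    by_cases h4 : y.2.1 = j <;>
    simp [keyTensor, kroneckerMap_apply, h1, h2, h3, h4, eq_comm (a := i), eq_comm (a := j)]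

theorem sum_smul_keyTensor_apply (σ : Matrix E E ℂ) (c : ℂ) (x y : Fin d × Fin d × E) :
    (∑ i, c • keyTensor i i σ) x y =
      if x.1 = x.2.1 ∧ x.1 = y.1 ∧ x.1 = y.2.1 then c * σ x.2.2 y.2.2 else 0 := by
  rw [Matrix.sum_apply, Finset.sum_eq_single x.1]
  · simp [keyTensor_apply, eq_comm]
  · intro i _ hi
    simp [keyTensor_apply, Ne.symm hi]
  · simp

theorem sum_sum_smul_keyTensor_apply (p : Fin d → Fin d → ℂ) (σ : Fin d → Fin d → Matrix E E ℂ)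
    (x y : Fin d × Fin d × E) :
    (∑ i, ∑ j, p i j • keyTensor i j (σ i j)) x y =
      if x.1 = y.1 ∧ x.2.1 = y.2.1 then p x.1 x.2.1 * σ x.1 x.2.1 x.2.2 y.2.2 else 0 := by
  rw [Matrix.sum_apply, Finset.sum_eq_single x.1, Matrix.sum_apply, Finset.sum_eq_single x.2.1]
  · simp [keyTensor_apply, eq_comm]
  · intro j _ hj
    simp [keyTensor_apply, Ne.symm hj]
  · simp
  · intro i _ hi
    rw [Matrix.sum_apply]
    exact Finset.sum_eq_zero fun j _ => by simp [keyTensor_apply, Ne.symm hi]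
  · simp

theorem IsCcq.trace_eq_one [Fintype E] {β : Matrix (Fin d × Fin d × E) (Fin d × Fin d × E) ℂ}
    (h : IsCcq β) : β.trace = 1 := by
  obtain ⟨p, σ, -, hp, hσ, rfl⟩ := h
  have h1 : ∀ i j, ∑ e, σ i j e e = 1 := fun i j => (hσ i j).2
  simp only [trace, diag_apply, sum_sum_smul_keyTensor_apply, Fintype.sum_prod_type, and_self,
    if_true, ← Finset.mul_sum, h1, mul_one]
  exact_mod_cast hp

theorem IsIdealCcq.isState [Fintype E] {β : Matrix (Fin d × Fin d × E) (Fin d × Fin d × E) ℂ}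
    (h : IsIdealCcq β) (hd : d ≠ 0) : IsState β := by
  obtain ⟨σ, hσ, rfl⟩ := h
  have hd' : (0 : ℂ) ≤ 1 / d := by
    rw [one_div, ← Complex.ofReal_natCast, ← Complex.ofReal_inv]
    exact Complex.zero_le_real.2 (by positivity)
  refine ⟨posSemidef_sum _ fun i _ => PosSemidef.smul ?_ hd', ?_⟩
  · have hs : ∀ i : Fin d, (single i i (1 : ℂ)).PosSemidef := fun i => by
      have := posSemidef_vecMulVec_self_star (Pi.single i (1 : ℂ))
      rwa [← Pi.single_star, star_one, ← single_eq_single_vecMulVec_single] at this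
    exact (hs i).kronecker ((hs i).kronecker hσ.1)
  · have hd0 : (d : ℂ) ≠ 0 := Nat.cast_ne_zero.2 hd
    rw [trace_sum]
    simp only [trace_smul, keyTensor, trace_kronecker, trace_single_eq_same, hσ.2]
    simp [hd0]

/-- The private state in standard form, the key bases being the standard bases. -/
noncomputable def standardPdit [Fintype S] [Fintype T] (σ : Matrix (S × T) (S × T) ℂ)
    (U : Fin d → Matrix (S × T) (S × T) ℂ) :
    Matrix ((Fin d × S) × (Fin d × T)) ((Fin d × S) × (Fin d × T)) ℂ :=
  of fun x y => if x.1.1 = x.2.1 ∧ y.1.1 = y.2.1 then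
    (1 / d : ℂ) * (U x.1.1 * σ * (U y.1.1)ᴴ) (x.1.2, x.2.2) (y.1.2, y.2.2) else 0

theorem sum_smul_single_kronecker_eq_standardPdit [Fintype S] [Fintype T]
    (σ : Matrix (S × T) (S × T) ℂ) (U : Fin d → Matrix (S × T) (S × T) ℂ) :
    (∑ i, ∑ j, (1 / d : ℂ) • ((single i j (1 : ℂ) ⊗ₖ single i j (1 : ℂ)) ⊗ₖ
      (U i * σ * (U j)ᴴ))).submatrix
        (Equiv.prodProdProdComm (Fin d) S (Fin d) T) (Equiv.prodProdProdComm (Fin d) S (Fin d) T) =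
      standardPdit σ U := by
  ext ⟨⟨i, s⟩, ⟨j, t⟩⟩ ⟨⟨i', s'⟩, ⟨j', t'⟩⟩
  simp only [submatrix_apply, Matrix.sum_apply, Equiv.prodProdProdComm_apply, Matrix.smul_apply,
    kroneckerMap_apply, single_apply, standardPdit, of_apply, smul_eq_mul]
  rw [Finset.sum_eq_single i, Finset.sum_eq_single i']
  · by_cases h1 : i = j <;> by_cases h2 : i' = j' <;> simp [h1, h2]
  · intro k _ hk
    simp [hk]
  · simp
  · intro k _ hk
    simp [hk]
  · simp

theorem isPdit_standardPdit [Fintype S] [Fintype T] [DecidableEq S] [DecidableEq T]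
    {σ : Matrix (S × T) (S × T) ℂ}
    {U : Fin d → Matrix (S × T) (S × T) ℂ} (hσ : IsState σ)
    (hU : ∀ i, U i ∈ unitaryGroup (S × T) ℂ) : IsPdit (standardPdit σ U) := by
  refine ⟨EuclideanSpace.basisFun _ _, EuclideanSpace.basisFun _ _, σ, U, hσ,
    fun i => by convert hU i, ?_⟩
  rw [← sum_smul_single_kronecker_eq_standardPdit]
  simp only [EuclideanSpace.basisFun_apply, PiLp.ofLp_single, ← Pi.single_star, star_one,
    single_eq_single_vecMulVec_single]

end Entries

/-! ### From classical key to private states -/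

section Regroup

variable {d : ℕ} {E S T : Type}

/-- A vector on the keys, Eve's system and the shields, given as a matrix with the shields as
columns, regrouped as a matrix with Eve's system as columns. -/
def regroup (Φ : Matrix (Fin d × Fin d × E) (S × T) ℂ) :
    Matrix ((Fin d × S) × (Fin d × T)) E ℂ :=
  of fun x e => Φ (x.1.1, x.2.1, e) (x.1.2, x.2.2)

theorem trace_regroup_conjTranspose_mul [Fintype E] [Fintype S] [Fintype T]
    (Ψ Φ : Matrix (Fin d × Fin d × E) (S × T) ℂ) :
    ((regroup Ψ)ᴴ * regroup Φ).trace = (Ψᴴ * Φ).trace := by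
  rw [← inner_hsVec, ← inner_hsVec, EuclideanSpace.inner_eq_star_dotProduct,
    EuclideanSpace.inner_eq_star_dotProduct]
  let e : ((Fin d × S) × (Fin d × T)) × E ≃ (Fin d × Fin d × E) × (S × T) :=
    { toFun := fun z => ((z.1.1.1, z.1.2.1, z.2), (z.1.1.2, z.1.2.2))
      invFun := fun z => (((z.1.1, z.2.1), (z.1.2.1, z.2.2)), z.1.2.2)
      left_inv := fun _ => rfl
      right_inv := fun _ => rfl }
  exact Fintype.sum_equiv e _ _ fun _ => rfl

/-- Every purification of an ideal ccq state, the purifying system being split into the shields,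
reduces to a private state on the side of Alice and Bob: the blocks of the
purification have equal reductions on Eve's system, so they differ by unitaries on the shields. -/
theorem isPdit_of_purifies_ideal [Fintype E] [Fintype S] [Fintype T]
    {Φ : Matrix (Fin d × Fin d × E) (S × T) ℂ} (hd : d ≠ 0) (h : IsIdealCcq (Φ * Φᴴ)) :
    IsPdit (regroup Φ * (regroup Φ)ᴴ) := by
  classical
  obtain ⟨σ, hσ, hΦ⟩ := h
  have hd0 : (d : ℂ) ≠ 0 := Nat.cast_ne_zero.2 hd
  let X : Fin d → Fin d → Matrix E (S × T) ℂ := fun i j => of fun e z => Φ (i, j, e) z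
  have hX : ∀ i j, X i j * (X i j)ᴴ = if i = j then (1 / d : ℂ) • σ else 0 := by
    intro i j
    ext e e'
    have h1 := congrFun (congrFun hΦ (i, j, e)) (i, j, e')
    rw [sum_smul_keyTensor_apply] at h1
    have h2 : (X i j * (X i j)ᴴ) e e' = (Φ * Φᴴ) (i, j, e) (i, j, e') := rfl
    rw [h2, h1]
    by_cases hij : i = j <;> simp [hij]
  have hX0 : ∀ i j, i ≠ j → X i j = 0 := fun i j hij =>
    self_mul_conjTranspose_eq_zero.1 (by rw [hX, if_neg hij])
  let o : Fin d := ⟨0, Nat.pos_of_ne_zero hd⟩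
  have hU : ∀ i, ∃ U ∈ unitaryGroup (S × T) ℂ, U * (X o o)ᴴ = (X i i)ᴴ := fun i =>
    exists_unitary_mul_eq (by
      rw [conjTranspose_conjTranspose, conjTranspose_conjTranspose, hX, hX, if_pos rfl,
        if_pos rfl])
  choose U hU hUX using hU
  have hV : ∀ i, (X i i)ᵀ = (U i)ᴴᵀ * (X o o)ᵀ := fun i => by
    rw [← conjTranspose_conjTranspose (X i i), ← hUX, conjTranspose_mul,
      conjTranspose_conjTranspose, transpose_mul]
  have hVu : ∀ i, (U i)ᴴᵀ ∈ unitaryGroup (S × T) ℂ := fun i =>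
    transpose_mem_unitaryGroup_iff.2 (Unitary.star_mem (hU i))
  have hstate : IsState ((d : ℂ) • ((X o o)ᵀ * (X o o)ᵀᴴ)) := by
    refine ⟨(posSemidef_self_mul_conjTranspose _).smul (Nat.cast_nonneg d), ?_⟩
    rw [trace_smul, show (X o o)ᵀᴴ = (X o o)ᴴᵀ from rfl, ← transpose_mul, trace_transpose,
      trace_mul_comm,
      hX, if_pos rfl, trace_smul, hσ.2]
    simp [hd0]
  have hγ : regroup Φ * (regroup Φ)ᴴ =
      standardPdit ((d : ℂ) • ((X o o)ᵀ * (X o o)ᵀᴴ)) fun i => (U i)ᴴᵀ := by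
    ext ⟨⟨i, s⟩, ⟨j, t⟩⟩ ⟨⟨i', s'⟩, ⟨j', t'⟩⟩
    have h1 : (regroup Φ * (regroup Φ)ᴴ) ((i, s), (j, t)) ((i', s'), (j', t')) =
      ((X i j)ᵀ * (X i' j')ᵀᴴ) (s, t) (s', t') := rfl
    rw [h1]
    by_cases hij : i = j
    · by_cases hij' : i' = j'
      · subst hij hij'
        rw [hV, hV i', conjTranspose_mul]
        simp only [standardPdit, of_apply, and_self, if_true, Matrix.mul_smul, Matrix.smul_mul,
          Matrix.smul_apply, smul_eq_mul]
        rw [← mul_assoc (1 / d : ℂ), one_div, inv_mul_cancel₀ hd0, one_mul]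
        simp only [Matrix.mul_assoc]
      · simp [standardPdit, hX0 i' j' hij', hij']
    · simp [standardPdit, hX0 i j hij, hij]
  rw [hγ]
  exact isPdit_standardPdit hstate hVu

theorem ancilla_mul_conjTranspose [Fintype S] [Fintype T] {N : Type} [Fintype N] [DecidableEq N]
    (k₀ : N) (ψ : (Fin d × S) × (Fin d × T) × E → ℂ) :
    (of fun x z => if z.1.2 = k₀ then ψ ((x.1, z.1.1), (x.2.1, z.2), x.2.2) else 0 :
        Matrix (Fin d × Fin d × E) ((S × N) × T) ℂ) *
      (of fun x z => if z.1.2 = k₀ then ψ ((x.1, z.1.1), (x.2.1, z.2), x.2.2) else 0 :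
        Matrix (Fin d × Fin d × E) ((S × N) × T) ℂ)ᴴ = traceShield ψ := by
  ext x y
  simp [traceShield, mul_apply, Fintype.sum_prod_type, apply_ite]

end Regroup

/-- From the ccq output of an LOPC operation to a private state: the shields are all that Alice and
Bob hold besides the keys after the coherent version of the operation. -/
theorem LOPCDistillsKey.loccDistillsPdit {A B E : Type} [Fintype A] [Fintype B] [Fintype E]
    {ψ : A × B × E → ℂ} {d : ℕ} {ε : ℝ} (h : LOPCDistillsKey (pureState ψ) d ε) :
    LOCCDistillsPdit (traceE (pureState ψ)) d (2 * √ε) := by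
  classical
  obtain ⟨E', iE, Λ, β, hΛ, hccq, hβ, hε⟩ := h
  let ψ₀ : (A × Unit) × (B × Unit) × E → ℂ := fun z => ψ (z.1.1, z.2.1.1, z.2.2)
  obtain ⟨S, T, _, _, iE', ψ', Λ', hΛ', h1, h2⟩ := hΛ.exists_coherent Unit Unit ψ₀
  cases Subsingleton.elim iE iE'
  have h0 : traceShield ψ₀ = pureState ψ := by
    ext x y
    simp [traceShield, ψ₀, pureState, vecMulVec_apply]
  rw [h0] at h2
  have htr := hccq.trace_eq_one
  rw [h2] at htr hε
  -- All systems are nonempty because the output has trace one.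
  have hne : ∃ k₀ : Fin d × Fin d × E', ∃ (s₀ : S) (t₀ : T), True := by
    by_contra hcon
    have h3 : (traceShield ψ').trace = 0 := Finset.sum_eq_zero fun x _ =>
      Finset.sum_eq_zero fun s _ => Finset.sum_eq_zero fun t _ => absurd ⟨x, s, t, trivial⟩ hcon
    rw [h3] at htr
    exact zero_ne_one htr
  obtain ⟨k₀, s₀, t₀, -⟩ := hne
  have hd : d ≠ 0 := fun h => by subst h; exact k₀.1.elim0
  -- Alice adds an ancilla, which makes the shields large enough for Uhlmann's theorem.
  let N := Fin d × Fin d × E'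
  let Ψ : Matrix (Fin d × Fin d × E') ((S × N) × T) ℂ := of fun x z =>
    if z.1.2 = k₀ then ψ' ((x.1, z.1.1), (x.2.1, z.2), x.2.2) else 0
  have hΨ : Ψ * Ψᴴ = traceShield ψ' := ancilla_mul_conjTranspose k₀ ψ'
  let w : N ↪ (S × N) × T := ⟨fun k => ((s₀, k), t₀), fun a b hab => by simpa using hab⟩
  obtain ⟨Φ, hΦ, hov⟩ := exists_purification_overlap Ψ w (hβ.isState hd) (by rw [hΨ, htr])
  have hlocc := ((IsLOCC.relabel (Equiv.prodPUnit A) (Equiv.prodPUnit B)).comp hΛ').comp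
    (IsLOCC.embed_alice (A := Fin d × S) (A' := Fin d × (S × N)) (f := fun z => (z.1, (z.2, k₀)))
      (g := fun z => (z.1, z.2.1)) fun _ => rfl)
  refine ⟨S × N, T, inferInstance, inferInstance, _, regroup Φ * (regroup Φ)ᴴ, hlocc,
    isPdit_of_purifies_ideal hd (hΦ ▸ hβ), ?_⟩
  have hin : (traceE (pureState ψ)).submatrix (Prod.map (Equiv.prodPUnit A) (Equiv.prodPUnit B))
      (Prod.map (Equiv.prodPUnit A) (Equiv.prodPUnit B)) = traceE (pureState ψ₀) := rfl
  have hout : (of fun x y =>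
      if (x.1.1, (x.1.2.1, k₀)) = x.1 ∧ (y.1.1, (y.1.2.1, k₀)) = y.1 then
        traceE (pureState ψ') ((x.1.1, x.1.2.1), x.2) ((y.1.1, y.1.2.1), y.2) else 0 :
        Matrix ((Fin d × (S × N)) × (Fin d × T)) ((Fin d × (S × N)) × (Fin d × T)) ℂ) =
      regroup Ψ * (regroup Ψ)ᴴ := by
    ext ⟨⟨i, s, k⟩, j, t⟩ ⟨⟨i', s', k'⟩, j', t'⟩
    by_cases hk : k = k₀ <;> by_cases hk' : k' = k₀ <;>
      simp [hk, hk', eq_comm (a := k₀), regroup, Ψ, mul_apply, traceE, pureState,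
        vecMulVec_apply]
  simp only [Function.comp_apply, hin, h1]
  rw [hout]
  have hΨ1 : (regroup Ψ * (regroup Ψ)ᴴ).trace = 1 := by
    rw [trace_mul_comm, trace_regroup_conjTranspose_mul, trace_mul_comm, hΨ, htr]
  have hΦ1 : (regroup Φ * (regroup Φ)ᴴ).trace = 1 := by
    rw [trace_mul_comm, trace_regroup_conjTranspose_mul, trace_mul_comm, hΦ, (hβ.isState hd).2]
  refine (traceNorm_sub_le_of_overlap hΨ1 hΦ1).trans ?_
  rw [trace_regroup_conjTranspose_mul]
  refine mul_le_mul_of_nonneg_left (Real.sqrt_le_sqrt ?_) two_pos.le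
  rw [hΨ] at hov
  have hε0 := (traceNorm_nonneg _).trans hε
  set c := (Ψᴴ * Φ).trace.re
  nlinarith [sq_nonneg (1 - c)]

/-! ### Coherent simulation of classical communication -/

/-- The operator on `ABE` obtained from the vector `ψ` by tracing out the system `F`, a part of
the environment that Eve does not get. -/
noncomputable def traceF {A B E F : Type} [Fintype F] (ψ : A × B × (E × F) → ℂ) :
    Matrix (A × B × E) (A × B × E) ℂ :=
  of fun x y => ∑ f, ψ (x.1, x.2.1, (x.2.2, f)) * star (ψ (y.1, y.2.1, (y.2.2, f)))

theorem traceF_eq {A B E F : Type} [Fintype F] (ψ : A × B × (E × F) → ℂ) :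
    traceF ψ =
      (of fun x f => ψ (x.1, x.2.1, (x.2.2, f)) : Matrix (A × B × E) F ℂ) *
      (of fun x f => ψ (x.1, x.2.1, (x.2.2, f)) : Matrix (A × B × E) F ℂ)ᴴ := by
  ext x y
  simp [traceF, mul_apply]

/-- Every LOCC operation is imitated by an LOPC operation in which Eve holds only a part `E'` of a
system purifying the output: the other part `F'` consists of the environments of the
channels and of a further copy of each message. -/
theorem IsLOCC.exists_coherent {A B A' B' : Type}
    {Λ : Matrix (A × B) (A × B) ℂ → Matrix (A' × B') (A' × B') ℂ}
    (h : IsLOCC Λ) : ∀ (E F : Type) [Fintype E] [Fintype F] (ψ : A × B × (E × F) → ℂ),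
    ∃ (E' F' : Type) (_ : Fintype E') (_ : Fintype F') (ψ' : A' × B' × (E' × F') → ℂ)
      (Λ' : Matrix (A × B × E) (A × B × E) ℂ → Matrix (A' × B' × E') (A' × B' × E') ℂ),
      IsLOPC Λ' ∧ Λ' (traceF ψ) = traceF ψ' ∧
        Λ (traceE (pureState ψ)) = traceE (pureState ψ') := by
  classical
  induction h with
  | refl =>
    intro E F _ _ ψ
    exact ⟨E, F, inferInstance, inferInstance, ψ, id, IsLOPC.refl, rfl, rfl⟩
  | comp _ _ ih ih' =>
    intro E F _ _ ψ
    obtain ⟨E', F', _, _, ψ', Λ', hΛ', h1, h2⟩ := ih E F ψ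
    obtain ⟨E'', F'', i1, i2, ψ'', Λ'', hΛ'', h3, h4⟩ := ih' E' F' ψ'
    exact ⟨E'', F'', i1, i2, ψ'', Λ'' ∘ Λ', hΛ'.comp hΛ'', by simp [h1, h3], by simp [h2, h4]⟩
  | @alice κ A A' B _ _ _ _ _ K hK =>
    intro E F _ _ ψ
    refine ⟨E, κ × F, inferInstance, inferInstance,
      fun z => ∑ a, K z.2.2.2.1 z.1 a * ψ (a, z.2.1, (z.2.2.1, z.2.2.2.2)), _,
      IsLOPC.alice K hK, ?_, ?_⟩
    · rw [traceF_eq]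
      ext x y
      rw [krausMap_mul_conjTranspose_apply]
      simp only [one_kronecker_one, kronecker_one_mul_apply]
      simp [traceF, Fintype.sum_prod_type]
    · rw [traceE_pureState_eq]
      ext x y
      rw [krausMap_mul_conjTranspose_apply]
      simp only [kronecker_one_mul_apply, traceE, pureState, vecMulVec_apply, of_apply,
        Fintype.sum_prod_type, Pi.star_apply]
      rw [Finset.sum_comm]
  | @bob κ A B B' _ _ _ _ _ K hK =>
    intro E F _ _ ψ
    refine ⟨E, κ × F, inferInstance, inferInstance,
      fun z => ∑ b, K z.2.2.2.1 z.2.1 b * ψ (z.1, b, (z.2.2.1, z.2.2.2.2)), _,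
      IsLOPC.bob K hK, ?_, ?_⟩
    · rw [traceF_eq]
      ext x y
      rw [krausMap_mul_conjTranspose_apply]
      simp only [one_kronecker_mul_apply, Fintype.sum_prod_type, kroneckerMap_apply, one_apply,
        traceF]
      simp
    · rw [traceE_pureState_eq]
      ext x y
      rw [krausMap_mul_conjTranspose_apply]
      simp only [one_kronecker_mul_apply, traceE, pureState, vecMulVec_apply, of_apply,
        Fintype.sum_prod_type, Pi.star_apply]
      rw [Finset.sum_comm]
  | @sendAB x A B _ _ _ _ =>
    intro E F _ _ ψ
    refine ⟨x × E, x × F, inferInstance, inferInstance,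
      fun z => if z.1.1 = z.2.1.1 ∧ z.1.1 = z.2.2.1.1 ∧ z.1.1 = z.2.2.2.1 then
        ψ (z.1, z.2.1.2, (z.2.2.1.2, z.2.2.2.2)) else 0, _, IsLOPC.sendAB, ?_, ?_⟩
    · ext ⟨⟨i, a⟩, ⟨j, b⟩, ⟨k, e⟩⟩ ⟨⟨i', a'⟩, ⟨j', b'⟩, ⟨k', e'⟩⟩
      by_cases h : i = i' ∧ i = j ∧ i = j' ∧ i = k ∧ i = k'
      · obtain ⟨rfl, rfl, rfl, rfl, rfl⟩ := h
        simp [traceF, publicAB, Fintype.sum_prod_type, ite_and]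
      · refine Eq.trans (by simp [publicAB, h]) (Finset.sum_eq_zero fun z _ => ?_).symm
        by_cases h1 : i = j ∧ i = k ∧ i = z.1
        · by_cases h2 : i' = j' ∧ i' = k' ∧ i' = z.1
          · have h3 : i = i' := h1.2.2.trans h2.2.2.symm
            exact absurd ⟨h3, h1.1, h3.trans h2.1, h1.2.1, h3.trans h2.2.1⟩ h
          · simp [h2]
        · simp [h1]
    · ext ⟨⟨i, a⟩, ⟨j, b⟩⟩ ⟨⟨i', a'⟩, ⟨j', b'⟩⟩
      by_cases h : i = i' ∧ i = j ∧ i = j'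
      · obtain ⟨rfl, rfl, rfl⟩ := h
        simp [traceE, pureState, vecMulVec_apply, classicalAB, Fintype.sum_prod_type, ite_and]
      · refine Eq.trans (by simp [classicalAB, h]) (Finset.sum_eq_zero fun z _ => ?_).symm
        simp only [pureState, vecMulVec_apply, Pi.star_apply]
        by_cases h1 : i = j ∧ i = z.1.1 ∧ i = z.2.1
        · by_cases h2 : i' = j' ∧ i' = z.1.1 ∧ i' = z.2.1
          · have h3 : i = i' := h1.2.2.trans h2.2.2.symm
            exact absurd ⟨h3, h1.1, h3.trans h2.1⟩ h
          · simp [h2]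
        · simp [h1]
  | @sendBA x A B _ _ _ _ =>
    intro E F _ _ ψ
    refine ⟨x × E, x × F, inferInstance, inferInstance,
      fun z => if z.2.1.1 = z.1.1 ∧ z.2.1.1 = z.2.2.1.1 ∧ z.2.1.1 = z.2.2.2.1 then
        ψ (z.1.2, z.2.1, (z.2.2.1.2, z.2.2.2.2)) else 0, _, IsLOPC.sendBA, ?_, ?_⟩
    · ext ⟨⟨j, a⟩, ⟨i, b⟩, ⟨k, e⟩⟩ ⟨⟨j', a'⟩, ⟨i', b'⟩, ⟨k', e'⟩⟩
      by_cases h : i = i' ∧ i = j ∧ i = j' ∧ i = k ∧ i = k'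
      · obtain ⟨rfl, rfl, rfl, rfl, rfl⟩ := h
        simp [traceF, publicBA, Fintype.sum_prod_type, ite_and]
      · refine Eq.trans (by simp [publicBA, h]) (Finset.sum_eq_zero fun z _ => ?_).symm
        by_cases h1 : i = j ∧ i = k ∧ i = z.1
        · by_cases h2 : i' = j' ∧ i' = k' ∧ i' = z.1
          · have h3 : i = i' := h1.2.2.trans h2.2.2.symm
            exact absurd ⟨h3, h1.1, h3.trans h2.1, h1.2.1, h3.trans h2.2.1⟩ h
          · simp [h2]
        · simp [h1]
    · ext ⟨⟨j, a⟩, ⟨i, b⟩⟩ ⟨⟨j', a'⟩, ⟨i', b'⟩⟩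
      by_cases h : i = i' ∧ i = j ∧ i = j'
      · obtain ⟨rfl, rfl, rfl⟩ := h
        simp [traceE, pureState, vecMulVec_apply, classicalBA, Fintype.sum_prod_type, ite_and]
      · refine Eq.trans (by simp [classicalBA, h]) (Finset.sum_eq_zero fun z _ => ?_).symm
        simp only [pureState, vecMulVec_apply, Pi.star_apply]
        by_cases h1 : i = j ∧ i = z.1.1 ∧ i = z.2.1
        · by_cases h2 : i' = j' ∧ i' = z.1.1 ∧ i' = z.2.1
          · have h3 : i = i' := h1.2.2.trans h2.2.2.symm
            exact absurd ⟨h3, h1.1, h3.trans h2.1⟩ h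
          · simp [h2]
        · simp [h1]

theorem trace_krausMap {κ A A' : Type} [Fintype κ] [Fintype A] [Fintype A'] [DecidableEq A]
    {K : κ → Matrix A' A ℂ} (hK : ∑ k, (K k)ᴴ * K k = 1) (X : Matrix A A ℂ) :
    (krausMap K X).trace = X.trace := by
  rw [krausMap, trace_sum]
  have h : ∀ k, (K k * X * (K k)ᴴ).trace = ((K k)ᴴ * K k * X).trace := fun k => by
    rw [trace_mul_comm, Matrix.mul_assoc]
  simp only [h]
  rw [← trace_sum, ← Matrix.sum_mul, hK, Matrix.one_mul]

theorem IsLOCC.trace_eq {A B A' B' : Type}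
    {Λ : Matrix (A × B) (A × B) ℂ → Matrix (A' × B') (A' × B') ℂ}
    (h : IsLOCC Λ) : ∃ (_ : Fintype A) (_ : Fintype B) (_ : Fintype A') (_ : Fintype B'),
      ∀ X, (Λ X).trace = X.trace := by
  classical
  induction h with
  | refl => exact ⟨inferInstance, inferInstance, inferInstance, inferInstance, fun _ => rfl⟩
  | comp _ _ ih ih' =>
    obtain ⟨i1, i2, i3, i4, h1⟩ := ih
    obtain ⟨i5, i6, i7, i8, h2⟩ := ih'
    cases Subsingleton.elim i3 i5
    cases Subsingleton.elim i4 i6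
    exact ⟨i1, i2, i7, i8, fun X => (h2 _).trans (h1 X)⟩
  | @alice κ A A' B _ _ _ _ _ K hK =>
    refine ⟨inferInstance, inferInstance, inferInstance, inferInstance, trace_krausMap ?_⟩
    have hK' : ∑ k, (K k)ᴴ * K k = 1 := hK
    simp only [conjTranspose_kronecker, ← mul_kronecker_mul, conjTranspose_one, Matrix.one_mul]
    rw [← one_kronecker_one, ← hK']
    ext x y
    simp [Matrix.sum_apply, kroneckerMap_apply, Finset.sum_mul]
  | @bob κ A B B' _ _ _ _ _ K hK =>
    refine ⟨inferInstance, inferInstance, inferInstance, inferInstance, trace_krausMap ?_⟩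
    have hK' : ∑ k, (K k)ᴴ * K k = 1 := hK
    simp only [conjTranspose_kronecker, ← mul_kronecker_mul, conjTranspose_one, Matrix.one_mul]
    rw [← one_kronecker_one, ← hK']
    ext x y
    simp [Matrix.sum_apply, kroneckerMap_apply, Finset.mul_sum]
  | @sendAB x A B _ _ _ _ =>
    refine ⟨inferInstance, inferInstance, inferInstance, inferInstance, fun X => ?_⟩
    simp only [trace, diag_apply, classicalAB, of_apply, Fintype.sum_prod_type, true_and,
      and_self]
    simp
  | @sendBA x A B _ _ _ _ =>
    refine ⟨inferInstance, inferInstance, inferInstance, inferInstance, fun X => ?_⟩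
    simp only [trace, diag_apply, classicalBA, of_apply, Fintype.sum_prod_type, true_and,
      and_self]
    rw [Finset.sum_comm]
    simp

/-! ### From private states to classical key -/

section Standardize

variable {d : ℕ} {S T : Type} [Fintype S] [Fintype T] [DecidableEq S] [DecidableEq T]

theorem kronecker_mem_unitaryGroup {m n : Type} [Fintype m] [Fintype n] [DecidableEq m]
    [DecidableEq n] {P : Matrix m m ℂ} {Q : Matrix n n ℂ} (hP : P ∈ unitaryGroup m ℂ)
    (hQ : Q ∈ unitaryGroup n ℂ) : P ⊗ₖ Q ∈ unitaryGroup (m × n) ℂ := by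
  rw [mem_unitaryGroup_iff, star_eq_conjTranspose] at *
  rw [conjTranspose_kronecker, ← mul_kronecker_mul, hP, hQ, one_kronecker_one]

theorem IsLOCC.local_unitary {A B : Type} [Fintype A] [Fintype B] [DecidableEq A] [DecidableEq B]
    {P : Matrix A A ℂ} {Q : Matrix B B ℂ} (hP : P ∈ unitaryGroup A ℂ)
    (hQ : Q ∈ unitaryGroup B ℂ) :
    IsLOCC fun X : Matrix (A × B) (A × B) ℂ => (P ⊗ₖ Q) * X * (P ⊗ₖ Q)ᴴ := by
  have hk : ∀ {C : Type} [Fintype C] [DecidableEq C] {R : Matrix C C ℂ}, R ∈ unitaryGroup C ℂ →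
      IsKraus fun _ : Unit => R := fun {C} _ _ {R} hR => by
    have h1 : Rᴴ * R = 1 := mem_unitaryGroup_iff'.1 hR
    simp only [IsKraus, Finset.univ_unique, Finset.sum_singleton, h1]
    ext i j
    simp [one_apply]
  convert (IsLOCC.alice (B := B) _ (hk hP)).comp (IsLOCC.bob (A := A) _ (hk hQ)) using 1
  funext X
  simp only [krausMap, Finset.univ_unique, Finset.sum_singleton, Function.comp_apply]
  have : P ⊗ₖ Q = ((1 : Matrix A A ℂ) ⊗ₖ Q) * (P ⊗ₖ (1 : Matrix B B ℂ)) := by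
    rw [← mul_kronecker_mul, Matrix.one_mul, Matrix.mul_one]
  rw [this, conjTranspose_mul]
  simp only [Matrix.mul_assoc]

/-- The unitary that takes an orthonormal basis to the standard basis. -/
noncomputable def toStandardBasis (e : OrthonormalBasis (Fin d) ℂ (EuclideanSpace ℂ (Fin d))) :
    Matrix (Fin d) (Fin d) ℂ :=
  of fun i a => star ((e i).ofLp a)

theorem toStandardBasis_mulVec (e : OrthonormalBasis (Fin d) ℂ (EuclideanSpace ℂ (Fin d)))
    (j : Fin d) : toStandardBasis e *ᵥ (e j).ofLp = Pi.single j 1 := by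
  ext i
  have h := orthonormal_iff_ite.1 e.orthonormal i j
  rw [EuclideanSpace.inner_eq_star_dotProduct, dotProduct_comm] at h
  refine Eq.trans h ?_
  simp [Pi.single_apply]

theorem toStandardBasis_mem_unitaryGroup
    (e : OrthonormalBasis (Fin d) ℂ (EuclideanSpace ℂ (Fin d))) :
    toStandardBasis e ∈ unitaryGroup (Fin d) ℂ := by
  rw [mem_unitaryGroup_iff]
  ext i j
  have h := congrFun (toStandardBasis_mulVec e j) i
  have h1 : (toStandardBasis e * star (toStandardBasis e)) i j =
      (toStandardBasis e *ᵥ (e j).ofLp) i := by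
    simp [Matrix.mul_apply, mulVec, dotProduct, star_apply, toStandardBasis]
  rw [h1, h, Pi.single_apply, one_apply]

theorem toStandardBasis_conj_vecMulVec
    (e : OrthonormalBasis (Fin d) ℂ (EuclideanSpace ℂ (Fin d))) (i j : Fin d) :
    toStandardBasis e * vecMulVec (e i).ofLp (star (e j).ofLp) * (toStandardBasis e)ᴴ =
      single i j 1 := by
  rw [mul_vecMulVec, vecMulVec_mul, ← star_mulVec, toStandardBasis_mulVec, toStandardBasis_mulVec,
    single_eq_single_vecMulVec_single, ← Pi.single_star, star_one]

/-- Local unitaries on the keys bring a private state into standard form. -/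
theorem IsPdit.exists_local_unitary_standardPdit
    {γ : Matrix ((Fin d × S) × (Fin d × T)) ((Fin d × S) × (Fin d × T)) ℂ} (h : IsPdit γ) :
    ∃ P ∈ unitaryGroup (Fin d × S) ℂ, ∃ Q ∈ unitaryGroup (Fin d × T) ℂ,
      ∃ (σ : Matrix (S × T) (S × T) ℂ) (U : Fin d → Matrix (S × T) (S × T) ℂ),
        IsState σ ∧ (∀ i, U i ∈ unitaryGroup (S × T) ℂ) ∧
        (P ⊗ₖ Q) * γ * (P ⊗ₖ Q)ᴴ = standardPdit σ U := by
  obtain ⟨e, f, σ, U, hσ, hU, rfl⟩ := h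
  refine ⟨toStandardBasis e ⊗ₖ 1,
    kronecker_mem_unitaryGroup (toStandardBasis_mem_unitaryGroup e) (one_mem _),
    toStandardBasis f ⊗ₖ 1,
    kronecker_mem_unitaryGroup (toStandardBasis_mem_unitaryGroup f) (one_mem _), σ, U, hσ,
    fun i => by convert hU i, ?_⟩
  have hB : (toStandardBasis e ⊗ₖ (1 : Matrix S S ℂ)) ⊗ₖ (toStandardBasis f ⊗ₖ (1 : Matrix T T ℂ)) =
      ((toStandardBasis e ⊗ₖ toStandardBasis f) ⊗ₖ (1 : Matrix (S × T) (S × T) ℂ)).submatrix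
        (Equiv.prodProdProdComm (Fin d) S (Fin d) T)
        (Equiv.prodProdProdComm (Fin d) S (Fin d) T) := by
    ext ⟨⟨i, s⟩, ⟨j, t⟩⟩ ⟨⟨i', s'⟩, ⟨j', t'⟩⟩
    simp only [← one_kronecker_one, submatrix_apply, kroneckerMap_apply,
      Equiv.prodProdProdComm_apply]
    ring
  rw [hB, conjTranspose_submatrix, submatrix_mul_equiv, submatrix_mul_equiv,
    ← sum_smul_single_kronecker_eq_standardPdit]
  congr 1
  simp only [Matrix.mul_sum, Matrix.sum_mul, Matrix.mul_smul, Matrix.smul_mul,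
    conjTranspose_kronecker, ← mul_kronecker_mul, conjTranspose_one, Matrix.one_mul,
    Matrix.mul_one, toStandardBasis_conj_vecMulVec]

end Standardize

section TwistedIsometry

variable {d : ℕ} {S T : Type} [Fintype S] [Fintype T]

/-- The isometry `(1 / √d) ∑ i, |ii⟩ ⊗ U i` from the shields into keys and shields. The private
state with twisting unitaries `U` is the image of the state of its shields. -/
noncomputable def twistedIsometry (U : Fin d → Matrix (S × T) (S × T) ℂ) :
    Matrix ((Fin d × S) × (Fin d × T)) (S × T) ℂ :=
  of fun x u => if x.1.1 = x.2.1 then (((√d)⁻¹ : ℝ) : ℂ) * U x.1.1 (x.1.2, x.2.2) u else 0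

theorem twistedIsometry_mul_apply {F : Type} (U : Fin d → Matrix (S × T) (S × T) ℂ)
    (χ : Matrix (S × T) F ℂ) (x : (Fin d × S) × (Fin d × T)) (f : F) :
    (twistedIsometry U * χ) x f =
      if x.1.1 = x.2.1 then (((√d)⁻¹ : ℝ) : ℂ) * (U x.1.1 * χ) (x.1.2, x.2.2) f else 0 := by
  by_cases h : x.1.1 = x.2.1 <;>
    simp [Matrix.mul_apply, twistedIsometry, h, Finset.mul_sum, mul_assoc]

theorem inv_sqrt_mul_inv_sqrt (d : ℕ) :
    (((√d)⁻¹ : ℝ) : ℂ) * (((√d)⁻¹ : ℝ) : ℂ) = 1 / d := by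
  rw [← Complex.ofReal_mul, ← mul_inv, Real.mul_self_sqrt (Nat.cast_nonneg d)]
  simp

theorem twistedIsometry_conjTranspose_mul_self [DecidableEq S] [DecidableEq T] (hd : d ≠ 0)
    {U : Fin d → Matrix (S × T) (S × T) ℂ} (hU : ∀ i, U i ∈ unitaryGroup (S × T) ℂ) :
    (twistedIsometry U)ᴴ * twistedIsometry U = 1 := by
  have hd0 : (d : ℂ) ≠ 0 := Nat.cast_ne_zero.2 hd
  ext u v
  have h1 : ∀ i, ∑ s, ∑ t, star (U i (s, t) u) * U i (s, t) v =
      (1 : Matrix (S × T) (S × T) ℂ) u v := fun i => by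
    rw [← mem_unitaryGroup_iff'.1 (hU i), mul_apply, Fintype.sum_prod_type]
    rfl
  have h2 : ((twistedIsometry U)ᴴ * twistedIsometry U) u v =
      ∑ i, (1 / d : ℂ) * ∑ s, ∑ t, star (U i (s, t) u) * U i (s, t) v := by
    rw [mul_apply]
    simp only [Fintype.sum_prod_type, conjTranspose_apply, twistedIsometry, of_apply,
      Finset.mul_sum, ← inv_sqrt_mul_inv_sqrt]
    refine Finset.sum_congr rfl fun i _ => Finset.sum_congr rfl fun s _ => ?_
    rw [Finset.sum_comm]
    refine Finset.sum_congr rfl fun t _ => ?_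
    simp [apply_ite]
    ring
  rw [h2]
  simp only [h1]
  simp [hd0]

theorem twistedIsometry_conj (σ : Matrix (S × T) (S × T) ℂ)
    (U : Fin d → Matrix (S × T) (S × T) ℂ) :
    twistedIsometry U * σ * (twistedIsometry U)ᴴ = standardPdit σ U := by
  ext x y
  rw [Matrix.mul_assoc, twistedIsometry_mul_apply]
  have h1 : ∀ u, (σ * (twistedIsometry U)ᴴ) u y = if y.1.1 = y.2.1 then
      (((√d)⁻¹ : ℝ) : ℂ) * (σ * (U y.1.1)ᴴ) u (y.1.2, y.2.2) else 0 := fun u => by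
    by_cases h : y.1.1 = y.2.1
    · simp only [mul_apply, conjTranspose_apply, twistedIsometry, of_apply, h, if_true,
        Finset.mul_sum, star_mul']
      refine Finset.sum_congr rfl fun v _ => ?_
      simp
      ring
    · simp [mul_apply, twistedIsometry, h]
  by_cases hx : x.1.1 = x.2.1
  · by_cases hy : y.1.1 = y.2.1
    · simp only [standardPdit, of_apply, hx, hy, and_self, if_true, ← inv_sqrt_mul_inv_sqrt,
        Matrix.mul_assoc]
      rw [mul_apply, mul_apply, Finset.mul_sum, Finset.mul_sum]
      refine Finset.sum_congr rfl fun u _ => ?_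
      rw [h1, if_pos hy, hy]
      ring
    · rw [Matrix.mul_apply]
      simp [standardPdit, hy, h1]
  · simp [standardPdit, hx]

end TwistedIsometry

/-! ### Measuring the keys -/

section Measurement

variable {d : ℕ} {A B E S T F : Type}

/-- Measure both keys in the standard bases and discard the shields. -/
noncomputable def measureKeys [Fintype S] [Fintype T]
    (X : Matrix ((Fin d × S) × (Fin d × T) × E) ((Fin d × S) × (Fin d × T) × E) ℂ) :
    Matrix (Fin d × Fin d × E) (Fin d × Fin d × E) ℂ :=
  of fun x y => if x.1 = y.1 ∧ x.2.1 = y.2.1 then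
    ∑ s, ∑ t, X ((x.1, s), (x.2.1, t), x.2.2) ((y.1, s), (y.2.1, t), y.2.2) else 0

theorem isKraus_measure [Fintype S] [DecidableEq S] :
    IsKraus fun k : Fin d × S => (single k.1 k 1 : Matrix (Fin d) (Fin d × S) ℂ) := by
  ext x y
  simp only [conjTranspose_single, star_one, single_mul_single_same, mul_one, Matrix.sum_apply,
    single_apply, one_apply]
  by_cases h : x = y
  · simp [h]
  · rw [Finset.sum_eq_zero fun z _ => if_neg fun hz => h (hz.1.symm.trans hz.2)]
    simp [h]

theorem isLOPC_measureKeys [Fintype E] [Fintype S] [Fintype T] :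
    IsLOPC (measureKeys (d := d) (E := E) (S := S) (T := T)) := by
  classical
  convert (IsLOPC.alice (B := Fin d × T) (E := E) _ (isKraus_measure (d := d) (S := S))).comp
    (IsLOPC.bob (A := Fin d) (E := E) _ (isKraus_measure (d := d) (S := T))) using 1
  funext X
  ext ⟨i, j, e⟩ ⟨i', j', e'⟩
  have h1 : ∀ (Z : Matrix (Fin d × (Fin d × T) × E) (Fin d × (Fin d × T) × E) ℂ),
      krausMap (fun k : Fin d × T => (1 : Matrix (Fin d) (Fin d) ℂ) ⊗ₖ
        ((single k.1 k 1 : Matrix (Fin d) (Fin d × T) ℂ) ⊗ₖ (1 : Matrix E E ℂ))) Z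
          (i, j, e) (i', j', e') =
      if j = j' then ∑ t, Z (i, (j, t), e) (i', (j', t), e') else 0 := fun Z => by
    rw [krausMap, Matrix.sum_apply]
    simp only [one_kronecker_conj_apply, Fintype.sum_prod_type, kroneckerMap_apply, one_apply,
      single_apply]
    by_cases hj : j = j'
    · subst hj
      simp [ite_and, apply_ite]
    · simp [ite_and, apply_ite, hj, Ne.symm hj]
  have h2 : ∀ (x y : (Fin d × T) × E),
      krausMap (fun k : Fin d × S => (single k.1 k 1 : Matrix (Fin d) (Fin d × S) ℂ) ⊗ₖ
        ((1 : Matrix (Fin d × T) (Fin d × T) ℂ) ⊗ₖ (1 : Matrix E E ℂ))) X (i, x) (i', y) =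
      if i = i' then ∑ s, X ((i, s), x) ((i', s), y) else 0 := fun x y => by
    rw [krausMap, Matrix.sum_apply]
    simp only [one_kronecker_one, kronecker_one_conj_apply, Fintype.sum_prod_type, single_apply]
    by_cases hi : i = i'
    · subst hi
      simp [ite_and, apply_ite]
    · simp [ite_and, apply_ite, hi, Ne.symm hi]
  rw [Function.comp_apply, h1]
  simp only [h2, measureKeys, of_apply]
  by_cases hi : i = i' <;> by_cases hj : j = j' <;> simp [hi, hj]
  exact Finset.sum_comm

/-- The vector `φ` after a coherent measurement of the keys, as a matrix whose columns are the
systems traced out by `measureKeys`: a copy of both keys, the shields and `F`. -/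
noncomputable def measuredVec (φ : (Fin d × S) × (Fin d × T) × (E × F) → ℂ) :
    Matrix (Fin d × Fin d × E) ((Fin d × S) × (Fin d × T) × F) ℂ :=
  of fun x z => if x.1 = z.1.1 ∧ x.2.1 = z.2.1.1 then φ (z.1, z.2.1, (x.2.2, z.2.2)) else 0

theorem measuredVec_mul_conjTranspose [Fintype S] [Fintype T] [Fintype F]
    (φ : (Fin d × S) × (Fin d × T) × (E × F) → ℂ) :
    measuredVec φ * (measuredVec φ)ᴴ = measureKeys (traceF φ) := by
  ext ⟨i, j, e⟩ ⟨i', j', e'⟩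
  by_cases h : i = i' ∧ j = j'
  · obtain ⟨rfl, rfl⟩ := h
    simp [mul_apply, measuredVec, measureKeys, traceF, Fintype.sum_prod_type, ite_and, apply_ite]
  · rw [mul_apply]
    refine (Finset.sum_eq_zero fun z _ => ?_).trans (by simp [measureKeys, h])
    simp only [measuredVec, conjTranspose_apply, of_apply]
    by_cases h1 : i = z.1.1 ∧ j = z.2.1.1
    · by_cases h2 : i' = z.1.1 ∧ j' = z.2.1.1
      · exact absurd ⟨h1.1.trans h2.1.symm, h1.2.trans h2.2.symm⟩ h
      · simp [h2]
    · simp [h1]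

theorem trace_measuredVec_conjTranspose_mul [Fintype S] [Fintype T] [Fintype E] [Fintype F]
    (φ χ : (Fin d × S) × (Fin d × T) × (E × F) → ℂ) :
    ((measuredVec φ)ᴴ * measuredVec χ).trace = ∑ z, star (φ z) * χ z := by
  simp only [trace, diag_apply, mul_apply, conjTranspose_apply, measuredVec, of_apply,
    Fintype.sum_prod_type]
  refine Finset.sum_congr rfl fun i _ => Finset.sum_congr rfl fun s _ =>
    Finset.sum_congr rfl fun j _ => Finset.sum_congr rfl fun t _ => ?_
  rw [Finset.sum_comm]
  simp only [ite_and]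
  simp [apply_ite]
  exact Finset.sum_comm

theorem isCcq_of_posSemidef [Fintype E]
    {β : Matrix (Fin d × Fin d × E) (Fin d × Fin d × E) ℂ} (hβ : β.PosSemidef)
    (htr : β.trace = 1) (hdiag : ∀ x y, ¬ (x.1 = y.1 ∧ x.2.1 = y.2.1) → β x y = 0) :
    IsCcq β := by
  classical
  have hne : Nonempty E := by
    by_contra h
    rw [not_nonempty_iff] at h
    simp [trace] at htr
  let e₀ := hne.some
  let G : Fin d → Fin d → Matrix E E ℂ := fun i j =>
    β.submatrix (fun e => (i, j, e)) (fun e => (i, j, e))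
  have hG : ∀ i j, (G i j).PosSemidef := fun i j => hβ.submatrix _
  have hre : ∀ i j, (G i j).trace = (((G i j).trace.re : ℝ) : ℂ) := fun i j => by
    obtain ⟨h1, h2⟩ := Complex.le_def.1 (hG i j).trace_nonneg
    exact Complex.ext rfl (by simpa using h2.symm)
  have h0 : ∀ i j, 0 ≤ (G i j).trace.re := fun i j =>
    (Complex.le_def.1 (hG i j).trace_nonneg).1
  -- Where the outcome has probability zero, the state of Eve is irrelevant.
  refine ⟨fun i j => (G i j).trace.re, fun i j => if (G i j).trace = 0 then single e₀ e₀ 1 else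
    ((G i j).trace)⁻¹ • G i j, h0, ?_, fun i j => ?_, ?_⟩
  · have : ((∑ i, ∑ j, (G i j).trace.re : ℝ) : ℂ) = 1 := by
      rw [← htr]
      push_cast
      simp only [← hre]
      simp only [trace, Fintype.sum_prod_type]
      rfl
    exact_mod_cast this
  · beta_reduce
    by_cases h : (G i j).trace = 0
    · rw [if_pos h]
      refine ⟨?_, by simp⟩
      have := posSemidef_vecMulVec_self_star (Pi.single e₀ (1 : ℂ))
      rwa [← Pi.single_star, star_one, ← single_eq_single_vecMulVec_single] at this
    · rw [if_neg h]
      refine ⟨(hG i j).smul ?_, by rw [trace_smul, smul_eq_mul, inv_mul_cancel₀ h]⟩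
      rw [hre, ← Complex.ofReal_inv]
      exact Complex.zero_le_real.2 (inv_nonneg.2 (h0 i j))
  · ext x y
    rw [sum_sum_smul_keyTensor_apply]
    by_cases hxy : x.1 = y.1 ∧ x.2.1 = y.2.1
    · rw [if_pos hxy, ← hre]
      have h1 : β x y = G x.1 x.2.1 x.2.2 y.2.2 := by
        obtain ⟨y1, y2, y3⟩ := y
        obtain ⟨rfl, rfl⟩ := hxy
        rfl
      rw [h1]
      by_cases h : (G x.1 x.2.1).trace = 0
      · rw [h, zero_mul, (hG x.1 x.2.1).trace_eq_zero_iff.1 h]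
        rfl
      · rw [if_neg h, Matrix.smul_apply, smul_eq_mul, mul_inv_cancel_left₀ h]
    · rw [if_neg hxy, hdiag x y hxy]

/-- Measuring the keys of a twisted maximally entangled state gives an ideal ccq state, whatever
the state `χ` of the shields and the environment was before the twisting. -/
theorem isIdealCcq_measureKeys_twisted [Fintype S] [Fintype T] [Fintype E] [Fintype F]
    [DecidableEq S] [DecidableEq T]
    {U : Fin d → Matrix (S × T) (S × T) ℂ} (hU : ∀ i, U i ∈ unitaryGroup (S × T) ℂ)
    {χ : Matrix (S × T) (E × F) ℂ} (hχ : (χᴴ * χ).trace = 1) :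
    IsIdealCcq (measureKeys (traceF fun z : (Fin d × S) × (Fin d × T) × (E × F) =>
      (twistedIsometry U * χ) (z.1, z.2.1) z.2.2)) := by
  let X : E → Matrix (S × T) F ℂ := fun e => of fun u f => χ u (e, f)
  let Z : Matrix E ((S × T) × F) ℂ := of fun e z => χ z.1 (e, z.2)
  have hZ : ∀ e e', (Z * Zᴴ) e e' = ((X e')ᴴ * X e).trace := fun e e' => by
    rw [← inner_hsVec, EuclideanSpace.inner_eq_star_dotProduct]
    rfl
  refine ⟨Z * Zᴴ, ⟨posSemidef_self_mul_conjTranspose Z, ?_⟩, ?_⟩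
  · rw [← hχ]
    simp only [trace, diag_apply, mul_apply, conjTranspose_apply, Z, of_apply,
      Fintype.sum_prod_type]
    refine Finset.sum_congr rfl fun e _ => ?_
    conv_rhs => rw [Finset.sum_comm]
    refine Finset.sum_congr rfl fun s _ => ?_
    rw [Finset.sum_comm]
    exact Finset.sum_congr rfl fun f _ => Finset.sum_congr rfl fun t _ => mul_comm _ _
  · ext ⟨i, j, e⟩ ⟨i', j', e'⟩
    rw [sum_smul_keyTensor_apply]
    by_cases h : i = j ∧ i = i' ∧ i = j'
    · obtain ⟨rfl, rfl, rfl⟩ := h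
      simp only [and_self, if_true]
      have h1 : ((U i * X e')ᴴ * (U i * X e)).trace = ((X e')ᴴ * X e).trace := by
        rw [conjTranspose_mul, Matrix.mul_assoc, ← Matrix.mul_assoc (U i)ᴴ,
          ← star_eq_conjTranspose (U i), mem_unitaryGroup_iff'.1 (hU i), Matrix.one_mul]
      rw [hZ, ← h1, ← inner_hsVec, EuclideanSpace.inner_eq_star_dotProduct]
      simp only [measureKeys, traceF, of_apply, and_self, if_true, twistedIsometry_mul_apply,
        dotProduct, Fintype.sum_prod_type, Finset.mul_sum]
      refine Finset.sum_congr rfl fun s _ => Finset.sum_congr rfl fun t _ =>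
        Finset.sum_congr rfl fun f _ => ?_
      have h2 : ∀ e, (U i * χ) (s, t) (e, f) = (U i * X e) (s, t) f := fun _ => rfl
      rw [← inv_sqrt_mul_inv_sqrt, h2, h2]
      simp [hsVec]
      ring
    · rw [if_neg h]
      simp only [measureKeys, traceF, of_apply, twistedIsometry_mul_apply]
      by_cases h1 : i = i' ∧ j = j'
      · have h2 : i ≠ j := fun h2 => h ⟨h2, h1.1, h2.trans h1.2⟩
        simp [h2]
      · rw [if_neg h1]

end Measurement

/-- A matrix has overlap `‖Y‖` with some unit vector, also if it vanishes. -/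
theorem exists_unit_overlap {m n : Type} [Fintype m] [Fintype n] [Nonempty m] [Nonempty n]
    (Y : Matrix m n ℂ) : ∃ χ : Matrix m n ℂ, (χᴴ * χ).trace = 1 ∧
      (Yᴴ * χ).trace.re ^ 2 = (Yᴴ * Y).trace.re := by
  classical
  have hself : ∀ χ : Matrix m n ℂ, (χᴴ * χ).trace = ((‖hsVec χ‖ ^ 2 : ℝ) : ℂ) := fun χ => by
    rw [← inner_hsVec, inner_self_eq_norm_sq_to_K]
    norm_cast
  by_cases hY : Y = 0
  · obtain ⟨i⟩ := ‹Nonempty m›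
    obtain ⟨j⟩ := ‹Nonempty n›
    exact ⟨single i j 1, by simp, by simp [hY]⟩
  · have h0 : ‖hsVec Y‖ ≠ 0 := fun h => hY <| by
      have h1 := hself Y
      rw [h] at h1
      exact trace_conjTranspose_mul_self_eq_zero_iff.1 (by simpa using h1)
    refine ⟨((‖hsVec Y‖⁻¹ : ℝ) : ℂ) • Y, ?_, ?_⟩
    · rw [conjTranspose_smul, Matrix.smul_mul, Matrix.mul_smul, trace_smul, trace_smul, hself]
      simp only [smul_eq_mul, RCLike.star_def, Complex.conj_ofReal, ← Complex.ofReal_mul]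
      rw [← Complex.ofReal_one]
      congr 1
      field_simp
    · rw [Matrix.mul_smul, trace_smul, hself, smul_eq_mul, ← Complex.ofReal_mul,
        Complex.ofReal_re, Complex.ofReal_re]
      field_simp

/-- From a private state to classical key: the ideal ccq state comes from the normalized projection
of the output onto the range of the twisted isometry, not from the given private state. -/
theorem LOCCDistillsPdit.lopcDistillsKey {A B E : Type} [Fintype A] [Fintype B] [Fintype E]
    {ψ : A × B × E → ℂ} (hψ : (traceE (pureState ψ)).trace = 1) {d : ℕ} {ε : ℝ}
    (h : LOCCDistillsPdit (traceE (pureState ψ)) d ε) :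
    LOPCDistillsKey (pureState ψ) d (√(2 * ε)) := by
  classical
  obtain ⟨S, T, iS, iT, Λ, γ, hΛ, hγ, hε⟩ := h
  obtain ⟨P, hP, Q, hQ, σ, U, hσ, hU, hstd⟩ := hγ.exists_local_unitary_standardPdit
  have hΛ₁ := hΛ.comp (IsLOCC.local_unitary hP hQ)
  have htr : ∀ X, (((P ⊗ₖ Q) * Λ X * (P ⊗ₖ Q)ᴴ)).trace = X.trace := fun X => by
    obtain ⟨i1, i2, i3, i4, h⟩ := hΛ₁.trace_eq
    have h' := h X
    simp only [Function.comp_apply] at h'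
    convert h'
  let ψ₀ : A × B × (E × Unit) → ℂ := fun z => ψ (z.1, z.2.1, z.2.2.1)
  obtain ⟨E', F, _, _, ψ', Λ', hΛ', h1, h2⟩ := hΛ₁.exists_coherent E Unit ψ₀
  have h0 : traceF ψ₀ = pureState ψ := by
    ext x y
    simp [traceF, ψ₀, pureState, vecMulVec_apply]
  have h0' : traceE (pureState ψ₀) = traceE (pureState ψ) := by
    ext x y
    simp [traceE, ψ₀, pureState, vecMulVec_apply, Fintype.sum_prod_type]
  rw [h0] at h1
  rw [h0'] at h2
  simp only [Function.comp_apply] at h2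
  -- Eve's system and the rest of the environment form the columns of `M`.
  let M : Matrix ((Fin d × S) × (Fin d × T)) (E' × F) ℂ := of fun x e => ψ' (x.1, x.2, e)
  have hM : (P ⊗ₖ Q) * Λ (traceE (pureState ψ)) * (P ⊗ₖ Q)ᴴ = M * Mᴴ := by
    rw [h2, traceE_pureState_eq]
  have hM1 : (M * Mᴴ).trace = 1 := by rw [← hM, htr, hψ]
  have hd : d ≠ 0 := by
    rintro rfl
    simp [trace] at hM1
  have hEF : Nonempty (E' × F) := by
    by_contra hne
    rw [not_nonempty_iff] at hne
    rw [trace_mul_comm] at hM1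
    simp [trace] at hM1
  have hST : Nonempty (S × T) := by
    by_contra hne
    rw [not_nonempty_iff] at hne
    have := hσ.2
    simp [trace] at this
  let V := twistedIsometry U
  have hV : Vᴴ * V = 1 := twistedIsometry_conjTranspose_mul_self hd hU
  obtain ⟨χ, hχ, hov⟩ := exists_unit_overlap (Vᴴ * M)
  -- The reflection `2 V Vᴴ - 1` tests how much of the output lies in the range of `V`.
  have hH : (2 : ℂ) • (V * Vᴴ) - 1 ∈ unitaryGroup ((Fin d × S) × (Fin d × T)) ℂ := by
    rw [mem_unitaryGroup_iff, star_eq_conjTranspose, conjTranspose_sub, conjTranspose_smul,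
      conjTranspose_mul, conjTranspose_conjTranspose, conjTranspose_one]
    have hVV : V * Vᴴ * (V * Vᴴ) = V * Vᴴ := by
      rw [Matrix.mul_assoc, ← Matrix.mul_assoc Vᴴ, hV, Matrix.one_mul]
    simp only [Matrix.sub_mul, Matrix.mul_sub, Matrix.smul_mul, Matrix.mul_smul, hVV,
      Matrix.one_mul, Matrix.mul_one, star_ofNat]
    module
  have hnorm : traceNorm (M * Mᴴ - V * σ * Vᴴ) ≤ ε := by
    rw [← hM, twistedIsometry_conj, ← hstd, ← Matrix.sub_mul, ← Matrix.mul_sub]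
    exact (traceNorm_unitary_conj_le (kronecker_mem_unitaryGroup hP hQ) _).trans hε
  have htest : (((2 : ℂ) • (V * Vᴴ) - 1) * (M * Mᴴ - V * σ * Vᴴ)).trace =
      2 * ((Vᴴ * M)ᴴ * (Vᴴ * M)).trace - 2 := by
    have e1 : (V * Vᴴ * (M * Mᴴ)).trace = ((Vᴴ * M)ᴴ * (Vᴴ * M)).trace := by
      rw [conjTranspose_mul, conjTranspose_conjTranspose, trace_mul_comm (Mᴴ * V), Matrix.mul_assoc,
        trace_mul_comm V]
      simp only [Matrix.mul_assoc]
    have e2 : (V * Vᴴ * (V * σ * Vᴴ)).trace = 1 := by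
      rw [Matrix.mul_assoc, Matrix.mul_assoc, ← Matrix.mul_assoc Vᴴ, hV, Matrix.one_mul,
        trace_mul_comm, Matrix.mul_assoc, hV, Matrix.mul_one, hσ.2]
    have e3 : (V * σ * Vᴴ).trace = 1 := by
      rw [trace_mul_comm, ← Matrix.mul_assoc, hV, Matrix.one_mul, hσ.2]
    simp only [Matrix.sub_mul, Matrix.mul_sub, Matrix.smul_mul, Matrix.one_mul, trace_sub,
      trace_smul, e1, e2, e3, hM1, smul_eq_mul]
    ring
  have hY : 1 - ε / 2 ≤ ((Vᴴ * M)ᴴ * (Vᴴ * M)).trace.re := by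
    have e1 := (Complex.abs_re_le_norm _).trans
      ((norm_trace_unitary_mul_le hH (M * Mᴴ - V * σ * Vᴴ)).trans hnorm)
    rw [htest] at e1
    have e2 := neg_abs_le (2 * ((Vᴴ * M)ᴴ * (Vᴴ * M)).trace - 2).re
    simp only [Complex.sub_re, Complex.mul_re, Complex.re_ofNat, Complex.im_ofNat, zero_mul,
      sub_zero] at e1 e2
    linarith
  let φ : (Fin d × S) × (Fin d × T) × (E' × F) → ℂ := fun z => (V * χ) (z.1, z.2.1) z.2.2
  have hsum : ∀ φ₁ φ₂ : (Fin d × S) × (Fin d × T) × (E' × F) → ℂ,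
      ∑ z, star (φ₁ z) * φ₂ z =
        ((of fun x e => φ₁ (x.1, x.2, e) : Matrix ((Fin d × S) × (Fin d × T)) (E' × F) ℂ)ᴴ *
          (of fun x e => φ₂ (x.1, x.2, e) :
            Matrix ((Fin d × S) × (Fin d × T)) (E' × F) ℂ)).trace := fun φ₁ φ₂ => by
    rw [← inner_hsVec, EuclideanSpace.inner_eq_star_dotProduct]
    refine (Fintype.sum_equiv (Equiv.prodAssoc _ _ _) _ _ fun z => ?_).symm
    exact mul_comm _ _
  have hNM : (measuredVec ψ' * (measuredVec ψ')ᴴ).trace = 1 := by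
    rw [trace_mul_comm, trace_measuredVec_conjTranspose_mul, hsum, trace_mul_comm]
    exact hM1
  have hNφ : (measuredVec φ * (measuredVec φ)ᴴ).trace = 1 := by
    rw [trace_mul_comm, trace_measuredVec_conjTranspose_mul, hsum]
    refine Eq.trans ?_ hχ
    change ((V * χ)ᴴ * (V * χ)).trace = _
    rw [conjTranspose_mul, Matrix.mul_assoc, ← Matrix.mul_assoc Vᴴ, hV, Matrix.one_mul]
  have hc : ((measuredVec ψ')ᴴ * measuredVec φ).trace = ((Vᴴ * M)ᴴ * χ).trace := by
    rw [trace_measuredVec_conjTranspose_mul, hsum, conjTranspose_mul, conjTranspose_conjTranspose,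
      Matrix.mul_assoc]
    rfl
  have hout : measureKeys (Λ' (pureState ψ)) = measuredVec ψ' * (measuredVec ψ')ᴴ := by
    rw [h1, measuredVec_mul_conjTranspose]
  refine ⟨E', inferInstance, measureKeys ∘ Λ', measuredVec φ * (measuredVec φ)ᴴ,
    hΛ'.comp isLOPC_measureKeys, ?_, ?_, ?_⟩
  · refine isCcq_of_posSemidef ?_ ?_ fun x y hxy => by simp [measureKeys, hxy]
    · rw [Function.comp_apply, hout]
      exact posSemidef_self_mul_conjTranspose _
    · rw [Function.comp_apply, hout, hNM]
  · rw [measuredVec_mul_conjTranspose]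
    exact isIdealCcq_measureKeys_twisted hU hχ
  · rw [Function.comp_apply, hout]
    refine (traceNorm_sub_le_of_overlap hNM hNφ).trans ?_
    rw [hc, hov]
    refine Real.le_sqrt_of_sq_le ?_
    rw [mul_pow]
    have hε0 := (traceNorm_nonneg _).trans hε
    rcases le_total 0 (1 - ((Vᴴ * M)ᴴ * (Vᴴ * M)).trace.re) with h | h
    · rw [Real.sq_sqrt h]
      linarith
    · rw [Real.sqrt_eq_zero_of_nonpos h]
      linarith

/-! ### Tensor powers and rates -/

section TensorPower

variable {A B E : Type}

/-- The `n`-fold tensor power of a tripartite vector. -/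
def tensorPowerVec (ψ : A × B × E → ℂ) (n : ℕ) :
    (Fin n → A) × (Fin n → B) × (Fin n → E) → ℂ :=
  fun z => ∏ k, ψ (z.1 k, z.2.1 k, z.2.2 k)

theorem tensorPower₃_pureState (ψ : A × B × E → ℂ) (n : ℕ) :
    tensorPower₃ (pureState ψ) n = pureState (tensorPowerVec ψ n) := by
  ext x y
  simp [tensorPower₃, pureState, vecMulVec_apply, tensorPowerVec, Finset.prod_mul_distrib]

theorem tensorPower₂_traceE [Fintype E] (ψ : A × B × E → ℂ) (n : ℕ) :
    tensorPower₂ (traceE (pureState ψ)) n = traceE (pureState (tensorPowerVec ψ n)) := by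
  classical
  ext x y
  rw [← tensorPower₃_pureState]
  simp only [tensorPower₂, tensorPower₃, traceE, of_apply]
  rw [Finset.prod_univ_sum, Fintype.piFinset_univ]

theorem trace_tensorPower₂ [Fintype A] [Fintype B] (ρ : Matrix (A × B) (A × B) ℂ) (n : ℕ) :
    (tensorPower₂ ρ n).trace = ρ.trace ^ n := by
  classical
  simp only [trace, diag_apply, tensorPower₂, of_apply]
  rw [← Fin.prod_const, Finset.prod_univ_sum, Fintype.piFinset_univ]
  exact (Fintype.sum_equiv (Equiv.arrowProdEquivProdArrow (Fin n) (fun _ => A) (fun _ => B)) _ _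
    fun z => rfl).symm

end TensorPower

end KeyDistill

theorem theorem7 {A B E : Type} [Fintype A] [Fintype B] [Fintype E]
    (ρ : Matrix (A × B) (A × B) ℂ) (hρ : KeyDistill.IsState ρ)
    (ψ : A × B × E → ℂ) (hψ : KeyDistill.IsPurification ψ ρ) :
    (∀ (d : ℕ) (ε : ℝ), KeyDistill.LOPCDistillsKey (KeyDistill.pureState ψ) d ε →
      KeyDistill.LOCCDistillsPdit ρ d (2 * √ε)) ∧
    (∀ (d : ℕ) (ε : ℝ), KeyDistill.LOCCDistillsPdit ρ d ε →
      KeyDistill.LOPCDistillsKey (KeyDistill.pureState ψ) d (√(2 * ε))) ∧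
    KeyDistill.distillableKey ρ = KeyDistill.distillableClassicalKey (KeyDistill.pureState ψ) := by
  obtain rfl : KeyDistill.traceE (KeyDistill.pureState ψ) = ρ := hψ
  refine ⟨fun d ε h => h.loccDistillsPdit, fun d ε h => h.lopcDistillsKey hρ.2, ?_⟩
  have htr : ∀ n, (KeyDistill.traceE
      (KeyDistill.pureState (KeyDistill.tensorPowerVec ψ n))).trace = 1 := fun n => by
    rw [← KeyDistill.tensorPower₂_traceE, KeyDistill.trace_tensorPower₂, hρ.2, one_pow]
  unfold KeyDistill.distillableKey KeyDistill.distillableClassicalKey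
  simp only [KeyDistill.tensorPower₂_traceE, KeyDistill.tensorPower₃_pureState]
  congr 1
  ext r
  constructor
  · rintro ⟨d, ε, hε, h, rfl⟩
    refine ⟨d, fun n => √(2 * ε n), ?_, fun n hn => (h n hn).lopcDistillsKey (htr n), rfl⟩
    simpa using (hε.const_mul 2).sqrt
  · rintro ⟨d, ε, hε, h, rfl⟩
    refine ⟨d, fun n => 2 * √(ε n), ?_, fun n hn => (h n hn).loccDistillsPdit, rfl⟩
    simpa using hε.sqrt.const_mul 2
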